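/- Throughout, $\|\cdot\|$ is the Frobenius norm, $A^{-\intercal}$ is the transpose of $A^{-1}$, $M<\infty$ is a constant not depending on any index, all limits and all $O_p(\cdot)$ are for $N,T\to\infty$ jointly, and $\delta_{NT}=\min(\sqrt N,\sqrt T)$. **Model.** Let $\pi$ be the break fraction, $T_1=\lfloor\pi T\rfloor$, $T_2=T-T_1$, $\iota_{1t}=1\{t\le T_1\}$, $\iota_{2t}=1\{t\ge T_1+1\}$. With random factors $f_t\in\mathbb R^r$, random loadings $\lambda_{m,i}\in\mathbb R^r$ ($m=1,2$; they may change with $N$) and errors $e_{it}$, write $F_1=(f_1,\dots,f_{T_1})^\intercal$, $F_2=(f_{T_1+1},\dots,f_T)^\intercal$, $\Lambda_m=(\lambda_{m,1},\dots,\lambda_{m,N})^\intercal$, and let $e_{(m)}$ be the $T_m\times N$ matrix of the errors of regime $m$. The data are $X_m=F_m\Lambda_m^\intercal+e_{(m)}$, and $\Lambda_2=\Lambda_1Z+W$ with $Z$ an $r\times r$ matrix (possibly random, possibly singular, possibly changing with $N$) and $W$ an $N\times r$ matrix. **Estimators.** $\tilde F_m$ is $\sqrt{T_m}$ times a $T_m\times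 r$ matrix of orthonormal eigenvectors of $X_mX_m^\intercal$ for its $r$ largest eigenvalues (in decreasing order), $V_{NT,m}$ is the diagonal matrix of the $r$ largest eigenvalues of $(NT_m)^{-1}X_mX_m^\intercal$, $\tilde\Lambda_m=T_m^{-1}X_m^\intercal\tilde F_m$, and $$\tilde Z=(\tilde\Lambda_1^\intercal\tilde\Lambda_1)^{-1}\tilde\Lambda_1^\intercal\tilde\Lambda_2,\qquad \tilde W=\tilde\Lambda_2-\tilde\Lambda_1\tilde Z,$$ $$H_1=\Big(\tfrac{\Lambda_1^\intercal\Lambda_1}{N}\Big)\Big(\tfrac{F_1^\intercal\tilde F_1}{T_1}\Big)V_{NT,1}^{-1},\qquad H_2=\Big(\tfrac{Z^\intercal\Lambda_1^\intercal\Lambda_1Z}{N}+\tfrac{W^\intercal W}{N}\Big)\Big(\tfrac{F_2^\intercal\tilde F_2}{T_2}\Big)V_{NT,2}^{-1}.$$ **Assumptions.** 1. $E\|f_t\|^4<\infty$, $E(f_tf_t^\intercal)=\Sigma_F$ for all $t$, and $T^{-1}\sum_{t\le T}f_tf_t^\intercal\to\Sigma_F$ in probability, with $\Sigma_F$ positive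 definite. 2. For $m=1,2$: $E\|\lambda_{m,i}\|^4\le M$; $\|\Lambda_m^\intercal\Lambda_m/N-\Sigma_{\Lambda_m}\|\to0$ in probability and is $O_p(N^{-1/2})$, with $\Sigma_{\Lambda_m}$ positive definite; and $\Lambda_1^\intercal W=O_p(1)$. 3. For all $N,T$: (a) $E e_{it}=0$, $E|e_{it}|^8\le M$. (b) With $\gamma_N(s,t)=E(N^{-1}\sum_{i\le N}e_{is}e_{it})$: $|\gamma_N(s,s)|\le M$ and $T^{-1}\sum_{s,t\le T}|\gamma_N(s,t)|\le M$. (c) $|E(e_{it}e_{jt})|\le\tau_{ij}$ for all $t$, with $N^{-1}\sum_{i,j\le N}|\tau_{ij}|\le M$. (d) $(NT)^{-1}\sum_{i,j\le N}\sum_{t,s\le T}|E(e_{it}e_{js})|\le M$. (e) $E|N^{-1/2}\sum_{i\le N}[e_{is}e_{it}-E(e_{is}e_{it})]|^4\le M$ for all $t,s$. 4. For each $m$, $\{\lambda_{m,i}\}$, $\{f_t\}$, $\{e_{it}\}$ are mutually independent groups. 5. For all $N,T$: $\sum_{s\le T}|\gamma_N(s,t)|\le M$ for $t\le T$, and $\sum_{k\le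 N}|\tau_{ki}|\le M$ for $i\le N$. 6. For all $N,T$ and $m=1,2$: (a) $E\|\frac1{NT}\sum_{s\le T}\sum_{k\le N}f_s[e_{ks}e_{kt}-E(e_{ks}e_{kt})]\iota_{ms}\|^2\le M$ for each $t\le T$; (b) $E\|\frac1{\sqrt{NT}}\sum_{t\le T}\sum_{k\le N}f_t\lambda_{m,k}^\intercal e_{kt}\iota_{mt}\|^2\le M$; (c) $E\|\frac1{\sqrt N}\sum_{i\le N}\lambda_{m,i}e_{it}\|^4\le M$ for each $t$. 7. For each $m=1,2$ the eigenvalues of $\Sigma_{\Lambda_m}\Sigma_F$ are distinct. 8. $0<\pi<1$ is fixed, and (a) for $m=1,2$, $\|\frac1{\sqrt{NT}}\sum_{t=1}^{T_1}\sum_{k\le N}f_t\lambda_{m,k}^\intercal e_{kt}\iota_{mt}\|^2=O_p(1)$ and $\|\frac1{\sqrt{NT}}\sum_{t=T_1+1}^{T}\sum_{k\le N}f_t\lambda_{m,k}^\intercal e_{kt}\iota_{mt}\|^2=O_p(1)$; (b) $\|\frac{\sqrt T}{T_1}\sum_{t=1}^{T_1}(f_tf_t^\intercal-\Sigma_F)\|=O_p(1)$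 and $\|\frac{\sqrt T}{T_2}\sum_{t=T_1+1}^{T}(f_tf_t^\intercal-\Sigma_F)\|=O_p(1)$. **Theorem.** Under Assumptions 1–8, as $N,T\to\infty$, the matrices $V_{NT,1}$, $V_{NT,2}$, $\tilde\Lambda_1^\intercal\tilde\Lambda_1$ and $H_2$ are invertible with probability tending to one, and $$\big\|\tilde Z-H_1^\intercal ZH_2^{-\intercal}\big\|=O_p\big(\delta_{NT}^{-2}\big),\qquad \frac1N\big\|\tilde W-WH_2^{-\intercal}\big\|^2=O_p\big(\delta_{NT}^{-2}\big).$$ -/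

import Mathlib

open MeasureTheory ProbabilityTheory Filter Topology

/- The norm of a real matrix is the Frobenius norm throughout. -/
attribute [local instance] Matrix.frobeniusNormedAddCommGroup

namespace FactorBreak

/-! ### Stochastic orders -/

/-- `X N T = O_p(a N T)` as `N, T → ∞` jointly. -/
def IsBigOp {Ω : Type*} [MeasurableSpace Ω] (P : Measure Ω)
    (X : ℕ → ℕ → Ω → ℝ) (a : ℕ → ℕ → ℝ) : Prop :=
  ∀ ε : ℝ, 0 < ε → ∃ C : ℝ, ∀ᶠ p : ℕ × ℕ in atTop,
    P {ω | C * a p.1 p.2 < |X p.1 p.2 ω|} ≤ ENNReal.ofReal ε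

/-- The expectation of `Y` exists and is at most `M`. -/
def ExpLE {Ω : Type*} [MeasurableSpace Ω] (P : Measure Ω) (Y : Ω → ℝ) (M : ℝ) : Prop :=
  Integrable Y P ∧ ∫ ω, Y ω ∂P ≤ M

/-- `δ_{NT} = min (√N, √T)`. -/
noncomputable def delta (N T : ℕ) : ℝ := min (Real.sqrt N) (Real.sqrt T)

/-! ### Principal components -/

/-- The matrix `(N n)⁻¹ X Xᵀ` of an `n × N` data matrix `X`. -/
noncomputable def scaledGram {n N : ℕ} (X : Matrix (Fin n) (Fin N) ℝ) :
    Matrix (Fin n) (Fin n) ℝ :=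
  ((N : ℝ) * (n : ℝ))⁻¹ • (X * X.transpose)

theorem scaledGram_isHermitian {n N : ℕ} (X : Matrix (Fin n) (Fin N) ℝ) :
    (scaledGram X).IsHermitian := by
  unfold scaledGram Matrix.IsHermitian
  rw [Matrix.conjTranspose_eq_transpose_of_trivial, Matrix.transpose_smul,
    Matrix.transpose_mul, Matrix.transpose_transpose]

/-- The `r` largest eigenvalues of `(N n)⁻¹ X Xᵀ`, with multiplicity, in decreasing order
(`eigenvalues₀` is the decreasing list of eigenvalues; the entries with index `≥ n`, which do not
exist, are set to `0`). -/
noncomputable def topEigenvalues {n N : ℕ} (r : ℕ) (X : Matrix (Fin n) (Fin N) ℝ) :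
    Fin r → ℝ := fun j =>
  if h : (j : ℕ) < n then
    (scaledGram_isHermitian X).eigenvalues₀ ⟨j, by rw [Fintype.card_fin]; exact h⟩
  else 0

/-- `F` is a principal components estimate of `r` factors from the `n × N` data matrix `X`: its
columns are `√n` times orthonormal eigenvectors of `X Xᵀ`, belonging to the `r` largest
eigenvalues in decreasing order. -/
structure IsPrincipalComponents {n N r : ℕ} (X : Matrix (Fin n) (Fin N) ℝ)
    (F : Matrix (Fin n) (Fin r) ℝ) : Prop where
  normalized : F.transpose * F = (n : ℝ) • (1 : Matrix (Fin r) (Fin r) ℝ)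
  eigen : scaledGram X * F = F * Matrix.diagonal (topEigenvalues r X)

/-- The least squares loadings `n⁻¹ Xᵀ F` of estimated factors with `Fᵀ F = n I`. -/
noncomputable def estLoadings {n N r : ℕ} (X : Matrix (Fin n) (Fin N) ℝ)
    (F : Matrix (Fin n) (Fin r) ℝ) : Matrix (Fin N) (Fin r) ℝ :=
  (n : ℝ)⁻¹ • (X.transpose * F)

/-- The projection coefficient `(L₁ᵀ L₁)⁻¹ L₁ᵀ L₂`. -/
noncomputable def projCoef {N r : ℕ} (L₁ L₂ : Matrix (Fin N) (Fin r) ℝ) :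
    Matrix (Fin r) (Fin r) ℝ :=
  (L₁.transpose * L₁)⁻¹ * L₁.transpose * L₂

/-! ### The factor model with one break -/

/-- The two regimes. -/
inductive Regime
  | pre
  | post

/-- The data of a factor model with `r` factors and one break. Time `t` and the series `i` are
numbered from `0`. The loadings, and the rotation `Z`, may be random and may change with `N`. -/
structure Model (Ω : Type*) [MeasurableSpace Ω] (r : ℕ) where
  /-- the break fraction -/
  frac : ℝ
  /-- the factors `f_t` -/
  f : ℕ → Ω → EuclideanSpace ℝ (Fin r)
  /-- the loadings `λ_{m,i}`, for `i < N` -/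
  lam : Regime → (N : ℕ) → Fin N → Ω → EuclideanSpace ℝ (Fin r)
  /-- the errors `e_{it}` -/
  e : ℕ → ℕ → Ω → ℝ
  /-- the rotational change -/
  Z : ℕ → Ω → Matrix (Fin r) (Fin r) ℝ
  measurable_f : ∀ t, Measurable (f t)
  measurable_lam : ∀ m N i, Measurable (lam m N i)
  measurable_e : ∀ i t, Measurable (e i t)

namespace Model

variable {Ω : Type*} [MeasurableSpace Ω] {r : ℕ} (D : Model Ω r)

/-- The number `⌊π T⌋` of periods before the break. -/
noncomputable def brk (T : ℕ) : ℕ := ⌊D.frac * (T : ℝ)⌋₊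

/-- The numbers `T₁ = ⌊π T⌋` and `T₂ = T - ⌊π T⌋` of periods in the two regimes. -/
noncomputable def len (m : Regime) (T : ℕ) : ℕ :=
  match m with
  | .pre => D.brk T
  | .post => T - D.brk T

/-- The first period of a regime. -/
noncomputable def start (m : Regime) (T : ℕ) : ℕ :=
  match m with
  | .pre => 0
  | .post => D.brk T

/-- The indicator `ι_{mt}` that period `t` belongs to regime `m`. -/
noncomputable def ind (m : Regime) (T t : ℕ) : ℝ :=
  match m with
  | .pre => if t < D.brk T then 1 else 0
  | .post => if D.brk T ≤ t then 1 else 0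

/-- The `T_m × r` matrix of the factors in regime `m`. -/
noncomputable def F (m : Regime) (T : ℕ) (ω : Ω) : Matrix (Fin (D.len m T)) (Fin r) ℝ :=
  Matrix.of fun t j => D.f (D.start m T + t) ω j

/-- The `T_m × N` matrix of the errors in regime `m`. -/
noncomputable def err (m : Regime) (N T : ℕ) (ω : Ω) : Matrix (Fin (D.len m T)) (Fin N) ℝ :=
  Matrix.of fun t i => D.e i (D.start m T + t) ω

/-- The `N × r` matrix of the loadings in regime `m`. -/
def Lam (m : Regime) (N : ℕ) (ω : Ω) : Matrix (Fin N) (Fin r) ℝ :=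
  Matrix.of fun i j => D.lam m N i ω j

/-- The orthogonal shift, defined by `Λ₂ = Λ₁ Z + W`. -/
def W (N : ℕ) (ω : Ω) : Matrix (Fin N) (Fin r) ℝ :=
  D.Lam .post N ω - D.Lam .pre N ω * D.Z N ω

/-- The observations `X_m = F_m Λ_mᵀ + e_m` in regime `m`. -/
noncomputable def X (m : Regime) (N T : ℕ) (ω : Ω) : Matrix (Fin (D.len m T)) (Fin N) ℝ :=
  D.F m T ω * (D.Lam m N ω).transpose + D.err m N T ω

/-- The diagonal matrix `V_{NT,m}` of the `r` largest eigenvalues of `(N T_m)⁻¹ X_m X_mᵀ`. -/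
noncomputable def V (m : Regime) (N T : ℕ) (ω : Ω) : Matrix (Fin r) (Fin r) ℝ :=
  Matrix.diagonal (topEigenvalues r (D.X m N T ω))

/-- `H₁ = (Λ₁ᵀ Λ₁ / N) (F₁ᵀ F̃₁ / T₁) V_{NT,1}⁻¹`. -/
noncomputable def H₁ (N T : ℕ) (ω : Ω) (Ft : Matrix (Fin (D.len .pre T)) (Fin r) ℝ) :
    Matrix (Fin r) (Fin r) ℝ :=
  ((N : ℝ)⁻¹ • ((D.Lam .pre N ω).transpose * D.Lam .pre N ω)) *
    ((D.len .pre T : ℝ)⁻¹ • ((D.F .pre T ω).transpose * Ft)) * (D.V .pre N T ω)⁻¹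

/-- `H₂ = (Zᵀ Λ₁ᵀ Λ₁ Z / N + Wᵀ W / N) (F₂ᵀ F̃₂ / T₂) V_{NT,2}⁻¹`. -/
noncomputable def H₂ (N T : ℕ) (ω : Ω) (Ft : Matrix (Fin (D.len .post T)) (Fin r) ℝ) :
    Matrix (Fin r) (Fin r) ℝ :=
  ((N : ℝ)⁻¹ • ((D.Z N ω).transpose * (D.Lam .pre N ω).transpose * D.Lam .pre N ω * D.Z N ω) +
      (N : ℝ)⁻¹ • ((D.W N ω).transpose * D.W N ω)) *
    ((D.len .post T : ℝ)⁻¹ • ((D.F .post T ω).transpose * Ft)) * (D.V .post N T ω)⁻¹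

/-! ### The assumptions -/

/-- The matrix `f_t f_tᵀ`. -/
noncomputable def ff (t : ℕ) (ω : Ω) : Matrix (Fin r) (Fin r) ℝ :=
  Matrix.vecMulVec (D.f t ω).ofLp (D.f t ω).ofLp

/-- `γ_N(s, t) = E (N⁻¹ ∑_i e_{is} e_{it})`. -/
noncomputable def gam (P : Measure Ω) (N s t : ℕ) : ℝ :=
  ∫ ω, (N : ℝ)⁻¹ * ∑ i ∈ Finset.range N, D.e i s ω * D.e i t ω ∂P

/-- `e_{is} e_{it} - E (e_{is} e_{it})`. -/
noncomputable def cov (P : Measure Ω) (i s t : ℕ) (ω : Ω) : ℝ :=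
  D.e i s ω * D.e i t ω - ∫ ω', D.e i s ω' * D.e i t ω' ∂P

/-- `∑_{a ≤ t < b} ∑_{k < N} f_t λ_{m,k}ᵀ e_{kt} ι_{mt}`. -/
noncomputable def flamSum (m : Regime) (N T a b : ℕ) (ω : Ω) : Matrix (Fin r) (Fin r) ℝ :=
  ∑ t ∈ Finset.Ico a b, ∑ k : Fin N,
    (D.e k t ω * D.ind m T t) • Matrix.vecMulVec (D.f t ω).ofLp (D.lam m N k ω).ofLp

/-- Factors. -/
structure Factors (P : Measure Ω) (SigF : Matrix (Fin r) (Fin r) ℝ) : Prop where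
  posDef : SigF.PosDef
  moment : ∀ t, Integrable (fun ω => ‖D.f t ω‖ ^ 4) P
  second : ∀ t i j, ∫ ω, D.f t ω i * D.f t ω j ∂P = SigF i j
  lln : TendstoInMeasure P
    (fun (T : ℕ) ω => ‖(T : ℝ)⁻¹ • ∑ t ∈ Finset.range T, D.ff t ω - SigF‖) atTop (fun _ => 0)

/-- Loadings. -/
structure Loadings (P : Measure Ω) (SigLam : Regime → Matrix (Fin r) (Fin r) ℝ) (M : ℝ) :
    Prop where
  posDef : ∀ m, (SigLam m).PosDef
  moment : ∀ m N i, ExpLE P (fun ω => ‖D.lam m N i ω‖ ^ 4) M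
  lln : ∀ m, TendstoInMeasure P
    (fun (N : ℕ) ω => ‖(N : ℝ)⁻¹ • ((D.Lam m N ω).transpose * D.Lam m N ω) - SigLam m‖)
    atTop (fun _ => 0)
  rate : ∀ m, IsBigOp P
    (fun N _ ω => ‖(N : ℝ)⁻¹ • ((D.Lam m N ω).transpose * D.Lam m N ω) - SigLam m‖)
    (fun N _ => (Real.sqrt N)⁻¹)
  orthogonal : IsBigOp P (fun N _ ω => ‖(D.Lam .pre N ω).transpose * D.W N ω‖) (fun _ _ => 1)

/-- Weak serial and cross-sectional dependence of the errors. -/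
structure Errors (P : Measure Ω) (tau : ℕ → ℕ → ℝ) (M : ℝ) : Prop where
  mean : ∀ i t, ∫ ω, D.e i t ω ∂P = 0
  moment : ∀ i t, ExpLE P (fun ω => |D.e i t ω| ^ 8) M
  gam_diag : ∀ N s, |D.gam P N s s| ≤ M
  gam_sum : ∀ N T : ℕ,
    (T : ℝ)⁻¹ * ∑ t ∈ Finset.range T, ∑ s ∈ Finset.range T, |D.gam P N s t| ≤ M
  tau_bound : ∀ i j t, |∫ ω, D.e i t ω * D.e j t ω ∂P| ≤ tau i j
  tau_sum : ∀ N : ℕ, (N : ℝ)⁻¹ * ∑ i ∈ Finset.range N, ∑ j ∈ Finset.range N, |tau i j| ≤ M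
  cross_sum : ∀ N T : ℕ, ((N : ℝ) * (T : ℝ))⁻¹ *
    ∑ i ∈ Finset.range N, ∑ j ∈ Finset.range N, ∑ t ∈ Finset.range T, ∑ s ∈ Finset.range T,
      |∫ ω, D.e i t ω * D.e j s ω ∂P| ≤ M
  fourth : ∀ N t s : ℕ, ExpLE P
    (fun ω => |(Real.sqrt N)⁻¹ * ∑ i ∈ Finset.range N, D.cov P i s t ω| ^ 4) M

/-- For each regime, the loadings, the factors and the errors are mutually independent groups. -/
def Independent (P : Measure Ω) : Prop :=
  ∀ (m : Regime) (N : ℕ), iIndep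
    ![MeasurableSpace.comap (fun ω (i : Fin N) => D.lam m N i ω) MeasurableSpace.pi,
      MeasurableSpace.comap (fun ω (t : ℕ) => D.f t ω) MeasurableSpace.pi,
      MeasurableSpace.comap (fun ω (p : ℕ × ℕ) => D.e p.1 p.2 ω) MeasurableSpace.pi] P

/-- Row sums of the error covariances are bounded. -/
structure ErrorRows (P : Measure Ω) (tau : ℕ → ℕ → ℝ) (M : ℝ) : Prop where
  gam_row : ∀ N T t : ℕ, t < T → ∑ s ∈ Finset.range T, |D.gam P N s t| ≤ M
  tau_row : ∀ N i : ℕ, i < N → ∑ k ∈ Finset.range N, |tau k i| ≤ M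

/-- Moment conditions. -/
structure Moments (P : Measure Ω) (M : ℝ) : Prop where
  first : ∀ (m : Regime) (N T t : ℕ), t < T → ExpLE P
    (fun ω => ‖((N : ℝ) * (T : ℝ))⁻¹ • ∑ s ∈ Finset.range T, ∑ k ∈ Finset.range N,
      (D.cov P k s t ω * D.ind m T s) • D.f s ω‖ ^ 2) M
  second : ∀ (m : Regime) (N T : ℕ), ExpLE P
    (fun ω => ‖(Real.sqrt ((N : ℝ) * (T : ℝ)))⁻¹ • D.flamSum m N T 0 T ω‖ ^ 2) M
  third : ∀ (m : Regime) (N t : ℕ), ExpLE P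
    (fun ω => ‖(Real.sqrt N)⁻¹ • ∑ i : Fin N, D.e i t ω • D.lam m N i ω‖ ^ 4) M

/-- The eigenvalues of `Σ_{Λ_m} Σ_F` are distinct, for each `m` (they are all real, being those of
a product of two positive definite matrices). -/
def DistinctEigenvalues (SigF : Matrix (Fin r) (Fin r) ℝ)
    (SigLam : Regime → Matrix (Fin r) (Fin r) ℝ) : Prop :=
  ∀ m, (SigLam m * SigF).charpoly.roots.Nodup

/-- The break fraction. -/
structure BreakFraction (P : Measure Ω) (SigF : Matrix (Fin r) (Fin r) ℝ) : Prop where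
  frac_pos : 0 < D.frac
  frac_lt_one : D.frac < 1
  sum_pre : ∀ m, IsBigOp P
    (fun N T ω => ‖(Real.sqrt ((N : ℝ) * (T : ℝ)))⁻¹ • D.flamSum m N T 0 (D.brk T) ω‖ ^ 2)
    (fun _ _ => 1)
  sum_post : ∀ m, IsBigOp P
    (fun N T ω => ‖(Real.sqrt ((N : ℝ) * (T : ℝ)))⁻¹ • D.flamSum m N T (D.brk T) T ω‖ ^ 2)
    (fun _ _ => 1)
  ff_pre : IsBigOp P
    (fun _ T ω => ‖(Real.sqrt T / (D.len .pre T : ℝ)) •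
      ∑ t ∈ Finset.Ico 0 (D.brk T), (D.ff t ω - SigF)‖) (fun _ _ => 1)
  ff_post : IsBigOp P
    (fun _ T ω => ‖(Real.sqrt T / (D.len .post T : ℝ)) •
      ∑ t ∈ Finset.Ico (D.brk T) T, (D.ff t ω - SigF)‖) (fun _ _ => 1)

end Model

end FactorBreak

/-!
The least squares loadings of regime `m` are `Λ̃_m = Λ_m A_m + B_m` with the rotation
`A_m = F_mᵀ F̃_m / T_m` and the error part `B_m = e_mᵀ F̃_m / T_m`, and their Gram matrix satisfies
`Λ̃_mᵀ Λ̃_m / N = V_{NT,m}` exactly. Write `d = 1 / δ_{NT}`.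

The eigenvector equation gives `F̃_m - F_m H_m = O_p(√T_m d)`. Splitting `F̃_m` into `F_m H_m` and
this remainder shows that `‖B_m‖² / N = O_p(d²)`, and that `Λᵀ B_m / N = O_p(d²)` for the loadings `Λ` of
either regime: the term with `F_m H_m` contains `F_mᵀ e_m Λ`, which is of order `√(N T)`, and the
other one is a product of two terms of relative order `d`. Hence `A_mᵀ H_m = 1 + O_p(d²)`, that is,
`A_m = H_m⁻ᵀ + O_p(d²)`, and

  `Z̃ = V₁⁻¹ (Λ̃₁ᵀ Λ̃₂ / N) = V₁⁻¹ A₁ᵀ (Λ₁ᵀ Λ₁ / N) Z A₂ + O_p(d²) = H₁ᵀ Z A₂ + O_p(d²)`,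

where `Λ₁ᵀ W / N = O_p(1 / N)` has been absorbed. The statement on `W̃` follows by inserting
`Λ̃_m = Λ_m A_m + B_m` in `Λ̃₂ - Λ̃₁ Z̃` and using `A₁ H₁ᵀ = 1 + O_p(d²)`.

The one spectral input is that `V_{NT,m}⁻¹` is bounded. By the min-max principle with the span of
the factors as the test space (`le_eigenvalues_of_forall`), it follows from the convergence of
`F_mᵀ X_m X_mᵀ F_m / (N T_m²)` to the positive definite matrix `Σ_F Σ_{Λ_m} Σ_F`.

The stochastic inputs are listed in `Model.primitive`: second moments of `e`, `e eᵀ`, `Fᵀ e`, `e Λ`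
and `Fᵀ e Λ`, bounded by Markov's inequality, and the rates at which the Gram matrices of factors
and loadings converge. The bound for `Fᵀ e Λ` comes from independence and the summability of the
covariances of the errors, because the loadings of one regime also meet the errors of the other.

From there on the argument is deterministic. By `exists_filter_of_isBigOp`, finitely many
`O_p` statements become ordinary `O` statements along a filter on `(ℕ × ℕ) × Ω` which loses only
probability `ε`; dividing factors, loadings and errors by `√T_m`, `√N` and `√(N T_m)` then leaves
only the orders `1`, `d` and `d²` (`normalized_break`).
-/

/-! ### Stochastic orders, and the norm of products of matrices -/

namespace FactorBreak

attribute [local instance] Matrix.frobeniusNormedSpace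

section Stochastic
open Asymptotics

variable {Ω : Type*} [MeasurableSpace Ω] {P : Measure Ω}

/-- The passage from stochastic orders to deterministic ones. Given finitely many `X i = O_p(a i)`
and `ε > 0`, each event `|X i| ≤ C i * a i` can be arranged to fail with probability at most
`ε / (k + 1)`, where `k` is the number of the `X i`. On the
filter `l` of joint limits restricted to the intersection of these events, `X i = O(a i)` in the
ordinary sense, and whatever holds eventually along `l` holds with probability at least `1 - ε`.
Nothing has to be measurable, since only subadditivity of the outer measure is used. -/
theorem exists_filter_of_isBigOp {ι : Type*} [Fintype ι]
    {X : ι → ℕ → ℕ → Ω → ℝ} {a : ι → ℕ → ℕ → ℝ} (hX : ∀ i, IsBigOp P (X i) (a i))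
    {ε : ℝ} (hε : 0 < ε) :
    ∃ l : Filter ((ℕ × ℕ) × Ω), Tendsto Prod.fst l atTop ∧
      (∀ i, (fun q => X i q.1.1 q.1.2 q.2) =O[l] (fun q => a i q.1.1 q.1.2)) ∧
      ∀ S : (ℕ × ℕ) × Ω → Prop, (∀ᶠ q in l, S q) →
        ∀ᶠ p in atTop, P {ω | ¬ S (p, ω)} ≤ ENNReal.ofReal ε := by
  set k : ℝ := Fintype.card ι + 1 with hk
  have hk0 : 0 < k := by positivity
  choose C hC using fun i => hX i (ε / k) (by positivity)
  refine ⟨comap Prod.fst atTop ⊓ 𝓟 {q | ∀ i, |X i q.1.1 q.1.2 q.2| ≤ C i * a i q.1.1 q.1.2},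
    tendsto_comap.mono_left inf_le_left, fun i => ?_, fun S hS => ?_⟩
  · refine IsBigO.of_bound |C i| ?_
    refine mem_inf_of_right fun q hq => ?_
    refine (hq i).trans ((le_abs_self _).trans ?_)
    rw [abs_mul, Real.norm_eq_abs]
  · rw [Filter.Eventually, mem_inf_principal, mem_comap] at hS
    obtain ⟨t, ht, hts⟩ := hS
    filter_upwards [ht, eventually_all.2 hC] with p hp hpC
    have hsub : {ω | ¬ S (p, ω)} ⊆ ⋃ i, {ω | C i * a i p.1 p.2 < |X i p.1 p.2 ω|} := by
      intro ω hω
      by_contra hcon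
      simp only [Set.mem_iUnion, Set.mem_ofPred_eq, not_exists, not_lt] at hcon
      exact hω (hts (show (p, ω) ∈ Prod.fst ⁻¹' t from hp) hcon)
    calc P {ω | ¬ S (p, ω)} ≤ ∑ i, P {ω | C i * a i p.1 p.2 < |X i p.1 p.2 ω|} :=
          (measure_mono hsub).trans (measure_iUnion_fintype_le _ _)
      _ ≤ ∑ _i : ι, ENNReal.ofReal (ε / k) := Finset.sum_le_sum fun i _ => hpC i
      _ = ENNReal.ofReal (Fintype.card ι * (ε / k)) := by
          rw [Finset.sum_const, Finset.card_univ, nsmul_eq_mul,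
            ENNReal.ofReal_mul (Nat.cast_nonneg _), ENNReal.ofReal_natCast]
      _ ≤ ENNReal.ofReal ε := by
          apply ENNReal.ofReal_le_ofReal
          rw [mul_div_assoc', div_le_iff₀ hk0, hk]
          nlinarith

/-- To prove `Y = O_p(b)` from finitely many `X i = O_p(a i)` it suffices to prove `Y = O(b)` along
every filter of joint limits on which `X i = O(a i)`. -/
theorem isBigOp_of_forall_filter {ι : Type*} [Fintype ι]
    {X : ι → ℕ → ℕ → Ω → ℝ} {a : ι → ℕ → ℕ → ℝ} (hX : ∀ i, IsBigOp P (X i) (a i))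
    {Y : ℕ → ℕ → Ω → ℝ} {b : ℕ → ℕ → ℝ} (hb : ∀ N T, 0 ≤ b N T)
    (h : ∀ l : Filter ((ℕ × ℕ) × Ω), Tendsto Prod.fst l atTop →
      (∀ i, (fun q => X i q.1.1 q.1.2 q.2) =O[l] (fun q => a i q.1.1 q.1.2)) →
      (fun q => Y q.1.1 q.1.2 q.2) =O[l] (fun q => b q.1.1 q.1.2)) :
    IsBigOp P Y b := by
  intro ε hε
  obtain ⟨l, hl, hXl, hS⟩ := exists_filter_of_isBigOp hX hε
  obtain ⟨C, hC⟩ := (h l hl hXl).bound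
  refine ⟨C, (hS _ hC).mono fun p hp => le_trans (measure_mono fun ω hω => ?_) hp⟩
  simp only [Set.mem_ofPred_eq, Real.norm_eq_abs, abs_of_nonneg (hb _ _), not_le] at hω ⊢
  exact hω

/-- An event that holds eventually along every filter of joint limits on which `X i = O(a i)` has
probability tending to one. -/
theorem tendsto_measure_of_forall_filter {ι : Type*} [Fintype ι]
    {X : ι → ℕ → ℕ → Ω → ℝ} {a : ι → ℕ → ℕ → ℝ} (hX : ∀ i, IsBigOp P (X i) (a i))
    {S : ℕ → ℕ → Ω → Prop}
    (h : ∀ l : Filter ((ℕ × ℕ) × Ω), Tendsto Prod.fst l atTop →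
      (∀ i, (fun q => X i q.1.1 q.1.2 q.2) =O[l] (fun q => a i q.1.1 q.1.2)) →
      ∀ᶠ q in l, S q.1.1 q.1.2 q.2) :
    Tendsto (fun p : ℕ × ℕ => P {ω | ¬ S p.1 p.2 ω}) atTop (𝓝 0) := by
  rw [ENNReal.tendsto_nhds_zero]
  intro ε hε
  obtain ⟨ε', hε'0, hε'⟩ := ENNReal.lt_iff_exists_nnreal_btwn.1 hε
  obtain ⟨l, hl, hXl, hS⟩ := exists_filter_of_isBigOp hX
    (ε := (ε' : ℝ)) (by exact_mod_cast hε'0)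
  refine (hS _ (h l hl hXl)).mono fun p hp => hp.trans ?_
  rw [ENNReal.ofReal_coe_nnreal]
  exact hε'.le

/-- Markov's inequality. -/
theorem isBigOp_of_integral_le [IsFiniteMeasure P] {Y : ℕ → ℕ → Ω → ℝ} {a : ℕ → ℕ → ℝ} (K : ℝ)
    (hY0 : ∀ N T ω, 0 ≤ Y N T ω) (hYi : ∀ N T, Integrable (Y N T) P)
    (hY : ∀ N T, ∫ ω, Y N T ω ∂P ≤ K * a N T)
    (ha : ∀ᶠ p : ℕ × ℕ in atTop, 0 < a p.1 p.2) : IsBigOp P Y a := by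
  intro ε hε
  refine ⟨(|K| + 1) / ε, ha.mono fun p hp => ?_⟩
  set c := (|K| + 1) / ε * a p.1 p.2 with hc
  have hc0 : 0 < c := by positivity
  have h1 := mul_meas_ge_le_integral_of_nonneg (μ := P)
    (Eventually.of_forall (hY0 p.1 p.2)) (hYi p.1 p.2) c
  have h2 : P.real {ω | c ≤ Y p.1 p.2 ω} ≤ ε := by
    have h3 : c * P.real {ω | c ≤ Y p.1 p.2 ω} ≤ c * ε := by
      refine (h1.trans (hY _ _)).trans ?_
      rw [hc, mul_right_comm, div_mul_cancel₀ _ hε.ne']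
      exact mul_le_mul_of_nonneg_right (by linarith [le_abs_self K]) hp.le
    exact le_of_mul_le_mul_left h3 hc0
  have h4 : {ω | c < |Y p.1 p.2 ω|} ⊆ {ω | c ≤ Y p.1 p.2 ω} := fun ω hω => by
    simp only [Set.mem_ofPred_eq, abs_of_nonneg (hY0 _ _ _)] at hω ⊢
    exact hω.le
  refine (measure_mono h4).trans ?_
  rw [← ENNReal.ofReal_toReal (measure_ne_top P {ω | c ≤ Y p.1 p.2 ω})]
  exact ENNReal.ofReal_le_ofReal h2

end Stochastic

section Norms

variable {m n k : Type*} [Fintype m] [Fintype n] [Fintype k]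

theorem norm_sq_eq_sum (A : Matrix m n ℝ) : ‖A‖ ^ 2 = ∑ i, ∑ j, A i j ^ 2 := by
  rw [Matrix.frobenius_norm_def, ← Real.sqrt_eq_rpow, Real.sq_sqrt (by positivity)]
  simp

theorem abs_apply_le_norm (A : Matrix m n ℝ) (i : m) (j : n) : |A i j| ≤ ‖A‖ := by
  refine abs_le_of_sq_le_sq ?_ (norm_nonneg _)
  rw [norm_sq_eq_sum]
  refine le_trans ?_ (Finset.single_le_sum (f := fun i => ∑ j, A i j ^ 2)
    (fun i _ => Finset.sum_nonneg fun j _ => sq_nonneg _) (Finset.mem_univ i))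
  exact Finset.single_le_sum (f := fun j => A i j ^ 2)
    (fun j _ => sq_nonneg _) (Finset.mem_univ j)

theorem norm_sq_le_card_mul (A : Matrix m n ℝ) :
    ‖A‖ ^ 2 ≤ Fintype.card n * ‖A.transpose * A‖ := by
  rw [norm_sq_eq_sum, Finset.sum_comm]
  calc ∑ j, ∑ i, A i j ^ 2 ≤ ∑ _j : n, ‖A.transpose * A‖ := by
        refine Finset.sum_le_sum fun j _ => ?_
        refine le_trans (le_of_eq ?_) ((le_abs_self _).trans (abs_apply_le_norm _ j j))
        simp [Matrix.mul_apply, sq]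
    _ = _ := by simp

theorem norm_transpose (A : Matrix m n ℝ) : ‖A.transpose‖ = ‖A‖ :=
  Matrix.frobenius_norm_transpose A

theorem norm_mul_le_mul (A : Matrix m n ℝ) (B : Matrix n k ℝ) : ‖A * B‖ ≤ ‖A‖ * ‖B‖ :=
  Matrix.frobenius_norm_mul A B

end Norms

section MatrixBigO
open Asymptotics

variable {α : Type*} {l : Filter α} {m n k : α → ℕ} {a b : α → ℝ}

theorem bigO_mul {A : ∀ q, Matrix (Fin (m q)) (Fin (n q)) ℝ}
    {B : ∀ q, Matrix (Fin (n q)) (Fin (k q)) ℝ}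
    (hA : (fun q => ‖A q‖) =O[l] a) (hB : (fun q => ‖B q‖) =O[l] b) :
    (fun q => ‖A q * B q‖) =O[l] fun q => a q * b q := by
  refine IsBigO.trans (IsBigO.of_bound 1 (Eventually.of_forall fun q => ?_)) (hA.mul hB)
  rw [one_mul, norm_norm, Real.norm_of_nonneg (by positivity)]
  exact norm_mul_le_mul _ _

theorem bigO_add {A B : ∀ q, Matrix (Fin (m q)) (Fin (n q)) ℝ}
    (hA : (fun q => ‖A q‖) =O[l] a) (hB : (fun q => ‖B q‖) =O[l] a) :
    (fun q => ‖A q + B q‖) =O[l] a := by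
  refine IsBigO.trans (IsBigO.of_bound 1 (Eventually.of_forall fun q => ?_)) (hA.add hB)
  rw [one_mul, norm_norm, Real.norm_of_nonneg (by positivity)]
  exact norm_add_le _ _

theorem bigO_sub {A B : ∀ q, Matrix (Fin (m q)) (Fin (n q)) ℝ}
    (hA : (fun q => ‖A q‖) =O[l] a) (hB : (fun q => ‖B q‖) =O[l] a) :
    (fun q => ‖A q - B q‖) =O[l] a := by
  refine IsBigO.trans (IsBigO.of_bound 1 (Eventually.of_forall fun q => ?_)) (hA.add hB)
  rw [one_mul, norm_norm, Real.norm_of_nonneg (by positivity)]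
  exact norm_sub_le _ _

theorem bigO_smul {A : ∀ q, Matrix (Fin (m q)) (Fin (n q)) ℝ} {c : α → ℝ}
    (hc : c =O[l] b) (hA : (fun q => ‖A q‖) =O[l] a) :
    (fun q => ‖c q • A q‖) =O[l] fun q => b q * a q := by
  simp_rw [norm_smul]
  exact hc.norm_left.mul hA

theorem bigO_transpose {A : ∀ q, Matrix (Fin (m q)) (Fin (n q)) ℝ}
    (hA : (fun q => ‖A q‖) =O[l] a) : (fun q => ‖(A q).transpose‖) =O[l] a := by
  simpa only [norm_transpose] using hA

theorem bigO_congr {A B : ∀ q, Matrix (Fin (m q)) (Fin (n q)) ℝ}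
    (hA : (fun q => ‖A q‖) =O[l] a) (h : ∀ᶠ q in l, B q = A q) :
    (fun q => ‖B q‖) =O[l] a :=
  hA.congr' (h.mono fun q hq => by simp only [hq]) EventuallyEq.rfl

theorem tendsto_of_bigO_norm_sub {r : ℕ} {A : α → Matrix (Fin r) (Fin r) ℝ}
    {S : Matrix (Fin r) (Fin r) ℝ} (hA : (fun q => ‖A q - S‖) =O[l] a) (ha : Tendsto a l (𝓝 0)) :
    Tendsto A l (𝓝 S) := by
  -- the topology on matrices is the entrywise one, so convergence is checked entrywise
  refine tendsto_pi_nhds.2 fun i => tendsto_pi_nhds.2 fun j => ?_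
  rw [tendsto_iff_norm_sub_tendsto_zero]
  exact squeeze_zero (fun _ => norm_nonneg _) (fun q => abs_apply_le_norm (A q - S) i j)
    (hA.trans_tendsto ha)

theorem bigO_one_of_tendsto {r : ℕ} {A : α → Matrix (Fin r) (Fin r) ℝ}
    {S : Matrix (Fin r) (Fin r) ℝ} (hA : Tendsto A l (𝓝 S)) :
    (fun q => ‖A q‖) =O[l] fun _ => (1 : ℝ) :=
  (hA.norm).isBigO_one ℝ

theorem eventually_isUnit_of_tendsto {r : ℕ} {A : α → Matrix (Fin r) (Fin r) ℝ}
    {S : Matrix (Fin r) (Fin r) ℝ} (hA : Tendsto A l (𝓝 S)) (hS : IsUnit S) :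
    (∀ᶠ q in l, IsUnit (A q)) ∧ (fun q => ‖(A q)⁻¹‖) =O[l] fun _ => (1 : ℝ) := by
  have hdet : S.det ≠ 0 := ((Matrix.isUnit_iff_isUnit_det S).1 hS).ne_zero
  have h1 : Tendsto (fun q => (A q).det) l (𝓝 S.det) :=
    (Continuous.matrix_det continuous_id).continuousAt.tendsto.comp hA
  refine ⟨(h1.eventually_ne hdet).mono fun q hq =>
    (Matrix.isUnit_iff_isUnit_det _).2 (isUnit_iff_ne_zero.2 hq), ?_⟩
  refine bigO_one_of_tendsto (S := S⁻¹) ?_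
  refine (continuousAt_matrix_inv S ?_).tendsto.comp hA
  rw [Ring.inverse_eq_inv']
  exact continuousAt_inv₀ hdet

end MatrixBigO
end FactorBreak

/-! ### Lower bounds for eigenvalues -/

namespace FactorBreak

attribute [local instance] Matrix.frobeniusNormedSpace

section Spectral

variable {E : Type*} [NormedAddCommGroup E] [InnerProductSpace ℝ E] [FiniteDimensional ℝ E]

theorem inner_apply_eq_sum_eigenvalues {T : E →ₗ[ℝ] E} (hT : T.IsSymmetric) {n : ℕ}
    (hn : Module.finrank ℝ E = n) (x : E) :
    inner ℝ x (T x) = ∑ i, hT.eigenvalues hn i * inner ℝ (hT.eigenvectorBasis hn i) x ^ 2 := by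
  rw [← (hT.eigenvectorBasis hn).sum_inner_mul_inner]
  refine Finset.sum_congr rfl fun i _ => ?_
  rw [← hT, hT.apply_eigenvectorBasis, real_inner_comm]
  simp only [RCLike.ofReal_real_eq_id, id_eq, inner_smul_left, conj_trivial]
  ring

/-- The lower half of the Courant–Fischer principle: if the quadratic form of `T` is at least `c` on
the unit vectors of an `r`-dimensional subspace, given as the range of an injective map `G`, then
the `r` largest eigenvalues of `T` are at least `c`. -/
theorem le_eigenvalues_of_forall {T : E →ₗ[ℝ] E} (hT : T.IsSymmetric) {n r : ℕ}
    (hn : Module.finrank ℝ E = n) (G : (Fin r → ℝ) →ₗ[ℝ] E) (hG : Function.Injective G) {c : ℝ}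
    (h : ∀ a, c * ‖G a‖ ^ 2 ≤ inner ℝ (G a) (T (G a))) (j : Fin n) (hj : (j : ℕ) < r) :
    c ≤ hT.eigenvalues hn j := by
  set v := hT.eigenvectorBasis hn
  -- `j` linear conditions leave a nonzero vector among the `r` coordinates
  let K : (Fin r → ℝ) →ₗ[ℝ] (Fin (j : ℕ) → ℝ) :=
    LinearMap.pi fun i => (innerₛₗ ℝ (v ⟨i, i.2.trans j.2⟩)).comp G
  have hK : LinearMap.ker K ≠ ⊥ := K.ker_ne_bot_of_finrank_lt (by simpa using hj)
  obtain ⟨a, haK, ha0⟩ := (Submodule.ne_bot_iff _).1 hK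
  have hv : ∀ i : Fin n, i < j → inner ℝ (v i) (G a) = 0 := fun i hi =>
    congrFun (LinearMap.mem_ker.1 haK) ⟨i, hi⟩
  have hpos : 0 < ‖G a‖ ^ 2 := by
    have : G a ≠ 0 := fun h0 => ha0 (hG (by rw [h0, map_zero]))
    positivity
  have hle : inner ℝ (G a) (T (G a)) ≤ hT.eigenvalues hn j * ‖G a‖ ^ 2 := by
    rw [inner_apply_eq_sum_eigenvalues hT hn, ← v.sum_sq_norm_inner_right (G a), Finset.mul_sum]
    refine Finset.sum_le_sum fun i _ => ?_
    rw [Real.norm_eq_abs, sq_abs]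
    rcases lt_or_ge i j with hi | hi
    · rw [hv i hi]; simp
    · exact mul_le_mul_of_nonneg_right (hT.eigenvalues_antitone hn hi) (sq_nonneg _)
  exact le_of_mul_le_mul_right ((h a).trans hle) hpos

end Spectral

open Matrix in
theorem norm_toLp_sq {ι : Type*} [Fintype ι] (a : ι → ℝ) : ‖WithLp.toLp 2 a‖ ^ 2 = a ⬝ᵥ a := by
  rw [EuclideanSpace.norm_sq_eq]
  simp [dotProduct, sq]

open Matrix in
theorem le_topEigenvalues {n N r : ℕ} (X : Matrix (Fin n) (Fin N) ℝ)
    (F : Matrix (Fin n) (Fin r) ℝ) (hr : r ≤ n) {c : ℝ}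
    (hF : ∀ a, F *ᵥ a = 0 → a = 0)
    (h : ∀ a, c * (F *ᵥ a ⬝ᵥ F *ᵥ a) ≤ F *ᵥ a ⬝ᵥ scaledGram X *ᵥ (F *ᵥ a)) (j : Fin r) :
    c ≤ topEigenvalues r X j := by
  have hj : (j : ℕ) < n := j.2.trans_le hr
  rw [topEigenvalues, dif_pos hj, Matrix.IsHermitian.eigenvalues₀]
  refine le_eigenvalues_of_forall (r := r) _ _
    ((WithLp.linearEquiv 2 ℝ (Fin n → ℝ)).symm.toLinearMap.comp F.mulVecLin) ?_ ?_ _ j.2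
  · rw [← LinearMap.ker_eq_bot, LinearMap.ker_eq_bot']
    intro a ha
    refine hF a ?_
    simpa using ha
  · intro a
    refine le_trans (le_of_eq ?_) ((h a).trans (le_of_eq ?_))
    · rw [← norm_toLp_sq]; rfl
    · simp [dotProduct, PiLp.inner_apply, mul_comm]

open Matrix in
theorem exists_le_dotProduct_mulVec {r : ℕ} {S : Matrix (Fin r) (Fin r) ℝ} (hS : S.PosDef) :
    ∃ c : ℝ, 0 < c ∧ ∀ a, c * (a ⬝ᵥ a) ≤ a ⬝ᵥ S *ᵥ a := by
  rcases isEmpty_or_nonempty (Fin r) with hr | hr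
  · exact ⟨1, one_pos, fun a => by simp [dotProduct]⟩
  have hT := isSymmetric_toEuclideanLin_iff.mpr hS.isHermitian
  have hn : Module.finrank ℝ (EuclideanSpace ℝ (Fin r)) = r := finrank_euclideanSpace_fin
  obtain ⟨i, hi⟩ := Finite.exists_min (hT.eigenvalues hn)
  have key : ∀ x : EuclideanSpace ℝ (Fin r),
      hT.eigenvalues hn i * ‖x‖ ^ 2 ≤ inner ℝ x (toEuclideanLin S x) := by
    intro x
    rw [inner_apply_eq_sum_eigenvalues hT hn, ← (hT.eigenvectorBasis hn).sum_sq_norm_inner_right x,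
      Finset.mul_sum]
    refine Finset.sum_le_sum fun k _ => ?_
    rw [Real.norm_eq_abs, sq_abs]
    exact mul_le_mul_of_nonneg_right (hi k) (sq_nonneg _)
  have hin : ∀ x : EuclideanSpace ℝ (Fin r),
      inner ℝ x (toEuclideanLin S x) = x.ofLp ⬝ᵥ S *ᵥ x.ofLp := by
    intro x
    simp [dotProduct, PiLp.inner_apply, mul_comm]
  refine ⟨hT.eigenvalues hn i, ?_, fun a => ?_⟩
  · have h1 := hT.apply_eigenvectorBasis hn i
    have h2 := hin (hT.eigenvectorBasis hn i)
    rw [h1, inner_smul_right, real_inner_self_eq_norm_sq,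
      (hT.eigenvectorBasis hn).orthonormal.1 i] at h2
    have h3 : (hT.eigenvectorBasis hn i).ofLp ≠ 0 := fun h0 => by
      have := (hT.eigenvectorBasis hn).orthonormal.1 i
      rw [(WithLp.ofLp_eq_zero 2).1 h0] at this
      simp at this
    have h4 := hS.dotProduct_mulVec_pos h3
    simp only [star_trivial] at h4
    rw [← h2] at h4
    simpa using h4
  · refine le_trans (le_of_eq ?_) ((key (WithLp.toLp 2 a)).trans (le_of_eq (hin _)))
    rw [norm_toLp_sq]

open Matrix in
theorem abs_dotProduct_mulVec_le {r : ℕ} (A : Matrix (Fin r) (Fin r) ℝ) (a : Fin r → ℝ) :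
    |a ⬝ᵥ A *ᵥ a| ≤ ‖A‖ * (a ⬝ᵥ a) := by
  set C : Matrix (Fin r) Unit ℝ := Matrix.of fun i _ => a i with hC
  have hn : ‖C‖ ^ 2 = a ⬝ᵥ a := by
    rw [norm_sq_eq_sum]; simp [hC, dotProduct, sq]
  have h1 : (C.transpose * (A * C)) () () = a ⬝ᵥ A *ᵥ a := by
    simp [hC, Matrix.mul_apply, dotProduct, mulVec]
  rw [← h1, ← hn]
  refine (abs_apply_le_norm _ _ _).trans ((norm_mul_le_mul _ _).trans ?_)
  rw [norm_transpose]
  calc ‖C‖ * ‖A * C‖ ≤ ‖C‖ * (‖A‖ * ‖C‖) := by gcongr; exact norm_mul_le_mul _ _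
    _ = _ := by ring

open Matrix in
/-- The `r` largest eigenvalues of the Gram matrices are eventually bounded away from zero as soon
as, in the directions of the columns of `F`, the Gram matrices have a positive definite limit. No
convergence of the eigenvalues themselves is needed, hence no separation of their limits. -/
theorem exists_eventually_le_topEigenvalues {α : Type*} {l : Filter α} {r : ℕ} {n N : α → ℕ}
    {X : ∀ q, Matrix (Fin (n q)) (Fin (N q)) ℝ} {F : ∀ q, Matrix (Fin (n q)) (Fin r) ℝ}
    {S Sig : Matrix (Fin r) (Fin r) ℝ} (hS : S.PosDef) (hSig : Sig.PosDef)
    (hn : ∀ᶠ q in l, r ≤ n q)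
    (hP : Tendsto (fun q => ‖(F q).transpose * F q - Sig‖) l (𝓝 0))
    (hY : Tendsto (fun q => ‖(F q).transpose * scaledGram (X q) * F q - S‖) l (𝓝 0)) :
    ∃ c : ℝ, 0 < c ∧ ∀ᶠ q in l, ∀ j, c ≤ topEigenvalues r (X q) j := by
  obtain ⟨c, hc, hcS⟩ := exists_le_dotProduct_mulVec hS
  obtain ⟨d, hd, hdS⟩ := exists_le_dotProduct_mulVec hSig
  set K := d + ‖Sig‖ with hK
  have hK0 : 0 < K := by positivity
  refine ⟨c / 2 / K, by positivity, ?_⟩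
  filter_upwards [hn, hP.eventually (gt_mem_nhds (half_pos hd)),
    hY.eventually (gt_mem_nhds (half_pos hc))] with q hq h1 h2
  have hin : ∀ a, F q *ᵥ a ⬝ᵥ F q *ᵥ a = a ⬝ᵥ ((F q).transpose * F q) *ᵥ a := by
    intro a
    rw [← mulVec_mulVec, dotProduct_mulVec a, vecMul_transpose]
  have hin2 : ∀ a, F q *ᵥ a ⬝ᵥ scaledGram (X q) *ᵥ (F q *ᵥ a) =
      a ⬝ᵥ ((F q).transpose * scaledGram (X q) * F q) *ᵥ a := by
    intro a
    rw [Matrix.mul_assoc, ← mulVec_mulVec, ← mulVec_mulVec, dotProduct_mulVec a, vecMul_transpose]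
  set A := (F q).transpose * F q with hA
  set B := (F q).transpose * scaledGram (X q) * F q with hB
  have haa : ∀ a : Fin r → ℝ, 0 ≤ a ⬝ᵥ a := fun a => by
    simpa using dotProduct_star_self_nonneg a
  have hdecA : ∀ a, a ⬝ᵥ A *ᵥ a = a ⬝ᵥ (A - Sig) *ᵥ a + a ⬝ᵥ Sig *ᵥ a := fun a => by
    rw [← dotProduct_add, ← add_mulVec, sub_add_cancel]
  have hdecB : ∀ a, a ⬝ᵥ B *ᵥ a = a ⬝ᵥ (B - S) *ᵥ a + a ⬝ᵥ S *ᵥ a := fun a => by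
    rw [← dotProduct_add, ← add_mulVec, sub_add_cancel]
  refine fun j => le_topEigenvalues (X q) (F q) hq ?_ ?_ j
  · intro a ha
    have h3 := hin a
    rw [ha, hdecA, dotProduct_zero] at h3
    have h4 := (abs_le.1 (abs_dotProduct_mulVec_le (A - Sig) a)).1
    have h5 := hdS a
    have h7 := mul_le_mul_of_nonneg_right h1.le (haa a)
    have h8 : a ⬝ᵥ a = 0 := by nlinarith [haa a]
    exact dotProduct_self_eq_zero.1 h8
  · intro a
    rw [hin, hin2, hdecA, hdecB]
    have h3 := (abs_le.1 (abs_dotProduct_mulVec_le (A - Sig) a)).2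
    have h4 := (abs_le.1 (abs_dotProduct_mulVec_le (B - S) a)).1
    have h5 := (abs_le.1 (abs_dotProduct_mulVec_le Sig a)).2
    have h6 := hcS a
    have h7 := mul_le_mul_of_nonneg_right h1.le (haa a)
    have h8 := mul_le_mul_of_nonneg_right h2.le (haa a)
    rw [div_mul_eq_mul_div, div_le_iff₀ hK0]
    have h9 : a ⬝ᵥ (A - Sig) *ᵥ a + a ⬝ᵥ Sig *ᵥ a ≤ K * (a ⬝ᵥ a) := by
      rw [hK]; nlinarith [haa a]
    have h10 : c / 2 * (a ⬝ᵥ a) ≤ a ⬝ᵥ (B - S) *ᵥ a + a ⬝ᵥ S *ᵥ a := by linarith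
    calc c / 2 * (a ⬝ᵥ (A - Sig) *ᵥ a + a ⬝ᵥ Sig *ᵥ a) ≤ c / 2 * (K * (a ⬝ᵥ a)) := by gcongr
      _ = (c / 2 * (a ⬝ᵥ a)) * K := by ring
      _ ≤ _ := by gcongr

theorem isUnit_diagonal_of_le {α : Type*} {l : Filter α} {r : ℕ} {v : α → Fin r → ℝ} {c : ℝ}
    (hc : 0 < c) (hv : ∀ᶠ q in l, ∀ j, c ≤ v q j) :
    (∀ᶠ q in l, IsUnit (Matrix.diagonal (v q))) ∧
      (fun q => ‖(Matrix.diagonal (v q))⁻¹‖) =O[l] fun _ => (1 : ℝ) := by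
  have hu : ∀ q, (∀ j, c ≤ v q j) →
      Matrix.diagonal (v q) * Matrix.diagonal (fun j => (v q j)⁻¹) = 1 := fun q hq => by
    rw [Matrix.diagonal_mul_diagonal, ← Matrix.diagonal_one]
    congr 1
    funext j
    exact mul_inv_cancel₀ (hc.trans_le (hq j)).ne'
  refine ⟨hv.mono fun q hq => IsUnit.of_mul_eq_one _ (hu q hq), ?_⟩
  refine Asymptotics.IsBigO.of_bound (∑ _j : Fin r, c⁻¹ ^ 2 + 1) (hv.mono fun q hq => ?_)
  rw [Matrix.inv_eq_right_inv (hu q hq), norm_norm, norm_one, mul_one]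
  have h1 : ‖Matrix.diagonal (fun j => (v q j)⁻¹)‖ ^ 2 ≤ ∑ _j : Fin r, c⁻¹ ^ 2 := by
    rw [norm_sq_eq_sum]
    refine Finset.sum_le_sum fun j _ => ?_
    rw [Finset.sum_eq_single j (fun k _ hk => by simp [Matrix.diagonal_apply_ne' _ hk]) (by simp),
      Matrix.diagonal_apply_eq]
    have := hc.trans_le (hq j)
    gcongr
    exact hq j
  nlinarith [sq_nonneg (‖Matrix.diagonal (fun j => (v q j)⁻¹)‖ - 1)]

end FactorBreak

/-! ### Principal components of a normalized factor model -/

namespace FactorBreak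

attribute [local instance] Matrix.frobeniusNormedSpace

section Normalized
open Asymptotics

variable {α : Type*} {l : Filter α} {r : ℕ} {n N : α → ℕ} {d : α → ℝ}

/-- Normalized loadings `lam` that are bounded and only weakly correlated with the normalized errors
`u`; `d` stands for `1 / δ_{NT}`. -/
structure WeaklyCorrelated (l : Filter α) (d : α → ℝ)
    (f : ∀ q, Matrix (Fin (n q)) (Fin r) ℝ) (u : ∀ q, Matrix (Fin (n q)) (Fin (N q)) ℝ)
    (lam : ∀ q, Matrix (Fin (N q)) (Fin r) ℝ) : Prop where
  bounded : (fun q => ‖lam q‖) =O[l] fun _ => (1 : ℝ)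
  err : (fun q => ‖u q * lam q‖) =O[l] d
  factor_err : (fun q => ‖(f q).transpose * u q * lam q‖) =O[l] fun q => d q * d q

/-- The orders of the normalized errors `u` of one regime, of their Gram matrix and of their
correlation with the normalized factors `f`; `d` stands for `1 / δ_{NT}`. -/
structure NormalizedErrors (l : Filter α) (d : α → ℝ)
    (f : ∀ q, Matrix (Fin (n q)) (Fin r) ℝ) (u : ∀ q, Matrix (Fin (n q)) (Fin (N q)) ℝ) :
    Prop where
  bounded : (fun q => ‖u q‖) =O[l] fun _ => (1 : ℝ)
  gram : (fun q => ‖u q * (u q).transpose‖) =O[l] d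
  factor_err : (fun q => ‖(f q).transpose * u q‖) =O[l] d

/-- The principal components `phi` of the data `x = f lamᵀ + u` of one regime, in the normalization
that removes all powers of `N` and `T_m`: `phiᵀ phi = 1` and `x xᵀ phi = phi V`. The estimated
loadings are `xᵀ phi`, the rotation is `fᵀ phi`, and `V` is bounded away from singularity. -/
structure NormalizedComponents (l : Filter α)
    (f : ∀ q, Matrix (Fin (n q)) (Fin r) ℝ) (u : ∀ q, Matrix (Fin (n q)) (Fin (N q)) ℝ)
    (lam : ∀ q, Matrix (Fin (N q)) (Fin r) ℝ) (x : ∀ q, Matrix (Fin (n q)) (Fin (N q)) ℝ)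
    (phi : ∀ q, Matrix (Fin (n q)) (Fin r) ℝ) (V : α → Matrix (Fin r) (Fin r) ℝ) : Prop where
  data : ∀ q, x q = f q * (lam q).transpose + u q
  orthonormal : ∀ᶠ q in l, (phi q).transpose * phi q = 1
  eigen : ∀ᶠ q in l, x q * (x q).transpose * phi q = phi q * V q
  isUnit : ∀ᶠ q in l, IsUnit (V q)
  inv_bounded : (fun q => ‖(V q)⁻¹‖) =O[l] fun _ => (1 : ℝ)

theorem isBigO_one_mul_self (hd : Tendsto d l (𝓝 0)) :
    (fun q => d q * d q) =O[l] d := by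
  simpa using (hd.isBigO_one ℝ).mul (isBigO_refl d l)

variable {f : ∀ q, Matrix (Fin (n q)) (Fin r) ℝ} {u : ∀ q, Matrix (Fin (n q)) (Fin (N q)) ℝ}
  {lam : ∀ q, Matrix (Fin (N q)) (Fin r) ℝ} {x : ∀ q, Matrix (Fin (n q)) (Fin (N q)) ℝ}
  {phi : ∀ q, Matrix (Fin (n q)) (Fin r) ℝ} {V : α → Matrix (Fin r) (Fin r) ℝ}

theorem bounded_of_gram {α : Type*} {l : Filter α} {r : ℕ} {n : α → ℕ}
    {A : ∀ q, Matrix (Fin (n q)) (Fin r) ℝ}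
    (hA : (fun q => ‖(A q).transpose * A q‖) =O[l] fun _ => (1 : ℝ)) :
    (fun q => ‖A q‖) =O[l] fun _ => (1 : ℝ) := by
  refine IsBigO.of_pow two_ne_zero (IsBigO.trans (IsBigO.of_bound r ?_) (hA.congr_right ?_))
  · refine Eventually.of_forall fun q => ?_
    rw [Pi.pow_apply, Real.norm_of_nonneg (by positivity), norm_norm]
    simpa using norm_sq_le_card_mul (A q)
  · intro q; simp

theorem norm_le_of_gram_eq_one {n r : ℕ} {p : Matrix (Fin n) (Fin r) ℝ}
    (h : p.transpose * p = 1) : ‖p‖ ≤ r * ‖(1 : Matrix (Fin r) (Fin r) ℝ)‖ + 1 := by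
  have := norm_sq_le_card_mul p
  rw [h, Fintype.card_fin] at this
  nlinarith [sq_nonneg (‖p‖ - 1)]

namespace NormalizedComponents

variable (h : NormalizedComponents l f u lam x phi V)
include h

theorem phi_bounded : (fun q => ‖phi q‖) =O[l] fun _ => (1 : ℝ) := by
  refine IsBigO.of_bound (r * ‖(1 : Matrix (Fin r) (Fin r) ℝ)‖ + 1)
    (h.orthonormal.mono fun q hq => ?_)
  rw [norm_norm, norm_one (α := ℝ), mul_one]
  exact norm_le_of_gram_eq_one hq

theorem loadings_eq (q : α) : (x q).transpose * phi q =
    lam q * ((f q).transpose * phi q) + (u q).transpose * phi q := by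
  rw [h.data, Matrix.transpose_add, Matrix.transpose_mul, Matrix.transpose_transpose,
    Matrix.add_mul, Matrix.mul_assoc]

/-- The Gram matrix of the estimated loadings is exactly `V`, without any error term. -/
theorem loadings_gram : ∀ᶠ q in l,
    ((x q).transpose * phi q).transpose * ((x q).transpose * phi q) = V q := by
  filter_upwards [h.orthonormal, h.eigen] with q h1 h2
  rw [Matrix.transpose_mul, Matrix.transpose_transpose, Matrix.mul_assoc, ← Matrix.mul_assoc (x q),
    h2, ← Matrix.mul_assoc, h1, Matrix.one_mul]

theorem rotation_bounded (hf : (fun q => ‖f q‖) =O[l] fun _ => (1 : ℝ)) :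
    (fun q => ‖(f q).transpose * phi q‖) =O[l] fun _ => (1 : ℝ) := by
  simpa using bigO_mul (bigO_transpose hf) h.phi_bounded

theorem H_bounded (hf : (fun q => ‖f q‖) =O[l] fun _ => (1 : ℝ))
    {G : α → Matrix (Fin r) (Fin r) ℝ} (hG : (fun q => ‖G q‖) =O[l] fun _ => (1 : ℝ)) :
    (fun q => ‖G q * ((f q).transpose * phi q) * (V q)⁻¹‖) =O[l] fun _ => (1 : ℝ) := by
  have := bigO_mul
    (bigO_mul hG (h.rotation_bounded hf))
    h.inv_bounded
  simpa using this

/-- The estimated factors are within `O(d)` of the rotated factors `f H`. -/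
theorem factors_sub (hf : (fun q => ‖f q‖) =O[l] fun _ => (1 : ℝ))
    (hu : NormalizedErrors l d f u) (hlam : WeaklyCorrelated l d f u lam) :
    (fun q => ‖phi q - f q *
      ((lam q).transpose * lam q * ((f q).transpose * phi q) * (V q)⁻¹)‖) =O[l] d := by
  have h1 := bigO_mul (bigO_mul hf (bigO_transpose hlam.err)) h.phi_bounded
  have h2 := bigO_mul hlam.err (h.rotation_bounded hf)
  have h3 := bigO_mul hu.gram h.phi_bounded
  simp only [one_mul, mul_one] at h1 h2 h3
  have h4 := bigO_mul (bigO_add (bigO_add h1 h2) h3) h.inv_bounded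
  simp only [mul_one] at h4
  refine bigO_congr h4 ?_
  filter_upwards [h.eigen, h.isUnit] with q h5 h6
  have h7 : phi q = x q * (x q).transpose * phi q * (V q)⁻¹ := by
    rw [h5, Matrix.mul_assoc, Matrix.mul_nonsing_inv _ ((Matrix.isUnit_iff_isUnit_det _).1 h6),
      Matrix.mul_one]
  refine (congrArg (fun y => y - _) h7).trans ?_
  rw [h.data]
  simp only [Matrix.transpose_add, Matrix.transpose_mul, Matrix.transpose_transpose,
    Matrix.add_mul, Matrix.mul_add, Matrix.mul_assoc]
  abel

/-- The error part `uᵀ phi` of the estimated loadings is `O(d)`: the part of `phi` in the span of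
the factors is nearly orthogonal to the errors, and the rest is small. -/
theorem projectedErrors (hf : (fun q => ‖f q‖) =O[l] fun _ => (1 : ℝ))
    (hu : NormalizedErrors l d f u) (hlam : WeaklyCorrelated l d f u lam) :
    (fun q => ‖(u q).transpose * phi q‖) =O[l] d := by
  have hG : (fun q => ‖(lam q).transpose * lam q‖) =O[l] fun _ => (1 : ℝ) := by
    simpa using bigO_mul (bigO_transpose hlam.bounded) hlam.bounded
  have h1 := bigO_mul (bigO_transpose hu.bounded) (h.factors_sub hf hu hlam)
  have h2 := bigO_mul (bigO_transpose hu.factor_err) (h.H_bounded hf hG)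
  simp only [one_mul, mul_one] at h1 h2
  refine bigO_congr (bigO_add h1 h2) (Eventually.of_forall fun q => ?_)
  simp only [Matrix.transpose_mul, Matrix.transpose_transpose, Matrix.mul_sub, Matrix.mul_assoc,
    sub_add_cancel]

/-- Multiplied by loadings, the error part of the estimated loadings gains a second factor `d`. The
loadings `mu` need not be those of the regime, which covers the cross terms between the regimes. -/
theorem loadings_projectedErrors
    (hf : (fun q => ‖f q‖) =O[l] fun _ => (1 : ℝ))
    (hu : NormalizedErrors l d f u) (hlam : WeaklyCorrelated l d f u lam)
    {mu : ∀ q, Matrix (Fin (N q)) (Fin r) ℝ} (hmu : WeaklyCorrelated l d f u mu) :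
    (fun q => ‖(mu q).transpose * ((u q).transpose * phi q)‖) =O[l] fun q => d q * d q := by
  have hG : (fun q => ‖(lam q).transpose * lam q‖) =O[l] fun _ => (1 : ℝ) := by
    simpa using bigO_mul (bigO_transpose hlam.bounded) hlam.bounded
  have h1 := bigO_mul (bigO_transpose hmu.err) (h.factors_sub hf hu hlam)
  have h2 := bigO_mul (bigO_transpose hmu.factor_err) (h.H_bounded hf hG)
  simp only [mul_one] at h1 h2
  refine bigO_congr (bigO_add h1 h2) (Eventually.of_forall fun q => ?_)
  simp only [Matrix.transpose_mul, Matrix.transpose_transpose, Matrix.mul_sub, Matrix.mul_assoc,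
    sub_add_cancel]

/-- The rotation `A = fᵀ phi` nearly diagonalizes the Gram matrix of the true loadings. -/
theorem rotation_gram (hf : (fun q => ‖f q‖) =O[l] fun _ => (1 : ℝ))
    (hu : NormalizedErrors l d f u) (hlam : WeaklyCorrelated l d f u lam) :
    (fun q => ‖V q - ((f q).transpose * phi q).transpose * ((lam q).transpose * lam q) *
      ((f q).transpose * phi q)‖) =O[l] fun q => d q * d q := by
  have hA := h.rotation_bounded hf
  have h1 := h.loadings_projectedErrors hf hu hlam hlam
  have hB := h.projectedErrors hf hu hlam
  have h2 := bigO_mul (bigO_transpose hA) h1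
  have h3 := bigO_mul (bigO_transpose h1) hA
  have h4 := bigO_mul (bigO_transpose hB) hB
  simp only [one_mul, mul_one] at h2 h3
  refine bigO_congr (bigO_add (bigO_add h2 h3) h4)
    (h.loadings_gram.mono fun q hq => ?_)
  rw [← hq, h.loadings_eq]
  simp only [Matrix.transpose_add, Matrix.transpose_mul, Matrix.transpose_transpose,
    Matrix.add_mul, Matrix.mul_add, Matrix.mul_assoc]
  abel

end NormalizedComponents

end Normalized
end FactorBreak

/-! ### Two regimes -/

namespace FactorBreak

attribute [local instance] Matrix.frobeniusNormedSpace

section Break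
open Asymptotics

variable {α : Type*} {l : Filter α} {r : ℕ} {d : α → ℝ}

/-- If `Aᵀ H` is within `O(d²)` of the identity, then `Aᵀ` is within `O(d²)` of `H⁻¹`. -/
theorem isBigO_inv_of_near_inverse (hd : Tendsto d l (𝓝 0)) {A H : α → Matrix (Fin r) (Fin r) ℝ}
    (hA : (fun q => ‖A q‖) =O[l] fun _ => (1 : ℝ))
    (hAH : (fun q => ‖(A q).transpose * H q - 1‖) =O[l] fun q => d q * d q) :
    (∀ᶠ q in l, IsUnit (H q)) ∧ ((fun q => ‖(H q)⁻¹‖) =O[l] fun _ => (1 : ℝ)) ∧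
      (fun q => ‖(A q).transpose - (H q)⁻¹‖) =O[l] fun q => d q * d q := by
  have h0 : Tendsto (fun q => d q * d q) l (𝓝 0) := by simpa using hd.mul hd
  obtain ⟨h1, h2⟩ := eventually_isUnit_of_tendsto (tendsto_of_bigO_norm_sub hAH h0) isUnit_one
  have h3 : ∀ᶠ q in l, ((A q).transpose * H q)⁻¹ * (A q).transpose * H q = 1 :=
    h1.mono fun q hq => by
      rw [Matrix.mul_assoc, Matrix.nonsing_inv_mul _ ((Matrix.isUnit_iff_isUnit_det _).1 hq)]
  have h4 : (fun q => ‖(H q)⁻¹‖) =O[l] fun _ => (1 : ℝ) := by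
    have h5 := bigO_mul h2
      (bigO_transpose hA)
    simp only [mul_one] at h5
    exact bigO_congr h5
      (h3.mono fun q hq => Matrix.inv_eq_left_inv hq)
  refine ⟨h3.mono fun q hq => IsUnit.of_mul_eq_one_right _ hq, h4, ?_⟩
  have h5 := bigO_mul hAH h4
  simp only [mul_one] at h5
  refine bigO_congr h5 (h3.mono fun q hq => ?_)
  have hu : IsUnit (H q) := IsUnit.of_mul_eq_one_right _ hq
  rw [Matrix.sub_mul, Matrix.one_mul, Matrix.mul_assoc,
    Matrix.mul_nonsing_inv _ ((Matrix.isUnit_iff_isUnit_det _).1 hu), Matrix.mul_one]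

theorem isBigO_transpose_mul_sub_one {A V K : α → Matrix (Fin r) (Fin r) ℝ} {a : α → ℝ}
    (hV : ∀ᶠ q in l, IsUnit (V q)) (hV' : (fun q => ‖(V q)⁻¹‖) =O[l] fun _ => (1 : ℝ))
    (hK : (fun q => ‖V q - (A q).transpose * K q * A q‖) =O[l] a) :
    (fun q => ‖(A q).transpose * (K q * A q * (V q)⁻¹) - 1‖) =O[l] a := by
  have h1 := bigO_mul hK hV'
  simp only [mul_one] at h1
  refine h1.congr' (hV.mono fun q hq => ?_) EventuallyEq.rfl
  simp only
  rw [Matrix.sub_mul, Matrix.mul_nonsing_inv _ ((Matrix.isUnit_iff_isUnit_det _).1 hq),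
    norm_sub_rev]
  simp only [Matrix.mul_assoc]

variable {n₁ n₂ N : α → ℕ}
  {f₁ : ∀ q, Matrix (Fin (n₁ q)) (Fin r) ℝ} {u₁ : ∀ q, Matrix (Fin (n₁ q)) (Fin (N q)) ℝ}
  {lam₁ : ∀ q, Matrix (Fin (N q)) (Fin r) ℝ} {x₁ : ∀ q, Matrix (Fin (n₁ q)) (Fin (N q)) ℝ}
  {phi₁ : ∀ q, Matrix (Fin (n₁ q)) (Fin r) ℝ} {V₁ : α → Matrix (Fin r) (Fin r) ℝ}
  {f₂ : ∀ q, Matrix (Fin (n₂ q)) (Fin r) ℝ} {u₂ : ∀ q, Matrix (Fin (n₂ q)) (Fin (N q)) ℝ}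
  {lam₂ : ∀ q, Matrix (Fin (N q)) (Fin r) ℝ} {x₂ : ∀ q, Matrix (Fin (n₂ q)) (Fin (N q)) ℝ}
  {phi₂ : ∀ q, Matrix (Fin (n₂ q)) (Fin r) ℝ} {V₂ : α → Matrix (Fin r) (Fin r) ℝ}
  {Z : α → Matrix (Fin r) (Fin r) ℝ} {w : ∀ q, Matrix (Fin (N q)) (Fin r) ℝ}

/-- The deterministic form of the result, for normalized quantities. Expanding
`L₁ᵀ L₂` with `L_m = lam_m A_m + u_mᵀ phi_m` shows that the projection coefficient is
`H₁ᵀ Z A₂ + O(d²)`, and `A₂` is `H₂⁻ᵀ` up to `O(d²)`. -/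
theorem normalized_break (hd : Tendsto d l (𝓝 0))
    (c₁ : NormalizedComponents l f₁ u₁ lam₁ x₁ phi₁ V₁)
    (c₂ : NormalizedComponents l f₂ u₂ lam₂ x₂ phi₂ V₂)
    (hf₁ : (fun q => ‖f₁ q‖) =O[l] fun _ => (1 : ℝ))
    (hf₂ : (fun q => ‖f₂ q‖) =O[l] fun _ => (1 : ℝ))
    (hu₁ : NormalizedErrors l d f₁ u₁) (hu₂ : NormalizedErrors l d f₂ u₂)
    (h₁₁ : WeaklyCorrelated l d f₁ u₁ lam₁) (h₁₂ : WeaklyCorrelated l d f₁ u₁ lam₂)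
    (h₂₁ : WeaklyCorrelated l d f₂ u₂ lam₁) (h₂₂ : WeaklyCorrelated l d f₂ u₂ lam₂)
    (hw : ∀ q, lam₂ q = lam₁ q * Z q + w q)
    (hZ : (fun q => ‖Z q‖) =O[l] fun _ => (1 : ℝ))
    (horth : (fun q => ‖(lam₁ q).transpose * w q‖) =O[l] fun q => d q * d q)
    {Zt H₁ H₂ : α → Matrix (Fin r) (Fin r) ℝ}
    (hZt : ∀ᶠ q in l, Zt q = projCoef ((x₁ q).transpose * phi₁ q) ((x₂ q).transpose * phi₂ q))
    (hH₁ : ∀ q, H₁ q = (lam₁ q).transpose * lam₁ q * ((f₁ q).transpose * phi₁ q) * (V₁ q)⁻¹)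
    (hH₂ : ∀ q, H₂ q = ((Z q).transpose * (lam₁ q).transpose * lam₁ q * Z q +
      (w q).transpose * w q) * ((f₂ q).transpose * phi₂ q) * (V₂ q)⁻¹) :
    (∀ᶠ q in l, IsUnit (H₂ q)) ∧
    ((fun q => ‖Zt q - (H₁ q).transpose * Z q * ((H₂ q)⁻¹).transpose‖) =O[l]
      fun q => d q * d q) ∧
    (fun q => ‖(x₂ q).transpose * phi₂ q - (x₁ q).transpose * phi₁ q * Zt q -
      w q * ((H₂ q)⁻¹).transpose‖) =O[l] d := by
  have hdd := isBigO_one_mul_self hd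
  have hdd1 : (fun q => d q * d q) =O[l] fun _ => (1 : ℝ) := hdd.trans (hd.isBigO_one ℝ)
  have hwb : (fun q => ‖w q‖) =O[l] fun _ => (1 : ℝ) := by
    have h1 := bigO_mul h₁₁.bounded hZ
    simp only [mul_one] at h1
    refine bigO_congr (bigO_sub h₂₂.bounded h1) (Eventually.of_forall fun q => ?_)
    rw [hw, add_sub_cancel_left]
  set A₁ : α → Matrix (Fin r) (Fin r) ℝ := fun q => (f₁ q).transpose * phi₁ q with hA₁d
  set A₂ : α → Matrix (Fin r) (Fin r) ℝ := fun q => (f₂ q).transpose * phi₂ q with hA₂d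
  set B₁ : ∀ q, Matrix (Fin (N q)) (Fin r) ℝ := fun q => (u₁ q).transpose * phi₁ q with hB₁d
  set B₂ : ∀ q, Matrix (Fin (N q)) (Fin r) ℝ := fun q => (u₂ q).transpose * phi₂ q with hB₂d
  have hA₁ : (fun q => ‖A₁ q‖) =O[l] fun _ => (1 : ℝ) := c₁.rotation_bounded hf₁
  have hA₂ : (fun q => ‖A₂ q‖) =O[l] fun _ => (1 : ℝ) := c₂.rotation_bounded hf₂
  have hB₁ : (fun q => ‖B₁ q‖) =O[l] d := c₁.projectedErrors hf₁ hu₁ h₁₁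
  have hB₂ : (fun q => ‖B₂ q‖) =O[l] d := c₂.projectedErrors hf₂ hu₂ h₂₂
  have hlB₁ : (fun q => ‖(lam₂ q).transpose * B₁ q‖) =O[l] fun q => d q * d q :=
    c₁.loadings_projectedErrors hf₁ hu₁ h₁₁ h₁₂
  have hlB₂ : (fun q => ‖(lam₁ q).transpose * B₂ q‖) =O[l] fun q => d q * d q :=
    c₂.loadings_projectedErrors hf₂ hu₂ h₂₂ h₂₁
  have hA₁t := bigO_transpose hA₁
  have hA₂t := bigO_transpose hA₂
  have hZT := bigO_transpose hZ
  have hoT := bigO_transpose horth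
  -- the first rotation
  have hH₁b : (fun q => ‖H₁ q‖) =O[l] fun _ => (1 : ℝ) := by
    have hG : (fun q => ‖(lam₁ q).transpose * lam₁ q‖) =O[l] fun _ => (1 : ℝ) := by
      simpa using bigO_mul (bigO_transpose h₁₁.bounded) h₁₁.bounded
    refine bigO_congr (c₁.H_bounded hf₁ hG)
      (Eventually.of_forall hH₁)
  obtain ⟨hU₁, -, hAH₁⟩ := isBigO_inv_of_near_inverse hd hA₁ (H := H₁) (by
    simpa only [hH₁] using isBigO_transpose_mul_sub_one c₁.isUnit c₁.inv_bounded
      (c₁.rotation_gram hf₁ hu₁ h₁₁))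
  -- the second rotation, whose definition omits the cross terms `Zᵀ lam₁ᵀ w + wᵀ lam₁ Z`
  -- of `lam₂ᵀ lam₂`
  obtain ⟨hU₂, -, hAH₂⟩ := isBigO_inv_of_near_inverse hd hA₂ (H := H₂) (by
    have h1 := c₂.rotation_gram hf₂ hu₂ h₂₂
    have h2 := bigO_mul hZT horth
    have h3 := bigO_mul hoT hZ
    simp only [one_mul, mul_one] at h2 h3
    have h4 := bigO_mul
      (bigO_mul hA₂t
      (bigO_add h2 h3)) hA₂
    simp only [one_mul, mul_one] at h4
    have h5 : (fun q => ‖V₂ q - (A₂ q).transpose * ((Z q).transpose * (lam₁ q).transpose *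
        lam₁ q * Z q + (w q).transpose * w q) * A₂ q‖) =O[l] fun q => d q * d q := by
      refine (bigO_add h1 h4).congr_left fun q => ?_
      congr 1
      rw [hw]
      simp only [hA₂d, Matrix.transpose_add, Matrix.transpose_mul,
        Matrix.transpose_transpose, Matrix.add_mul, Matrix.mul_add, Matrix.mul_assoc]
      abel
    simpa only [hH₂] using isBigO_transpose_mul_sub_one c₂.isUnit c₂.inv_bounded h5)
  have hAH₂t : (fun q => ‖A₂ q - ((H₂ q)⁻¹).transpose‖) =O[l] fun q => d q * d q := by
    simpa only [Matrix.transpose_sub, Matrix.transpose_transpose] using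
      bigO_transpose hAH₂
  -- the projection coefficient
  have hZA : (fun q => ‖Zt q - (H₁ q).transpose * Z q * A₂ q‖) =O[l] fun q => d q * d q := by
    have h1 := bigO_mul
      (bigO_mul hA₁t horth) hA₂
    have h2 := bigO_mul hA₁t hlB₂
    have h3 := bigO_mul
      (bigO_transpose hlB₁) hA₂
    have h4 := bigO_mul (bigO_transpose hB₁) hB₂
    simp only [one_mul, mul_one] at h1 h2 h3
    have h5 := bigO_mul c₁.inv_bounded
      (bigO_add (bigO_add
      (bigO_add h1 h2) h3) h4)
    simp only [one_mul] at h5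
    refine bigO_congr h5 ?_
    filter_upwards [c₁.loadings_gram, hZt] with q hq hZq
    have hVt : (V₁ q).transpose = V₁ q := by
      rw [← hq, Matrix.transpose_mul, Matrix.transpose_transpose]
    rw [hZq, projCoef, hq, hH₁, c₁.loadings_eq, c₂.loadings_eq, hw]
    rw [Matrix.transpose_mul _ (V₁ q)⁻¹, Matrix.transpose_nonsing_inv, hVt]
    simp only [hA₁d, hA₂d, hB₁d, hB₂d, Matrix.transpose_add, Matrix.transpose_mul,
      Matrix.transpose_transpose, Matrix.add_mul, Matrix.mul_add, Matrix.mul_assoc]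
    abel
  have hZH : (fun q => ‖Zt q - (H₁ q).transpose * Z q * ((H₂ q)⁻¹).transpose‖) =O[l]
      fun q => d q * d q := by
    have h1 := bigO_mul
      (bigO_mul
      (bigO_transpose hH₁b) hZ) hAH₂t
    simp only [one_mul] at h1
    refine (bigO_add hZA h1).congr_left fun q => ?_
    rw [Matrix.mul_sub, sub_add_sub_cancel]
  refine ⟨hU₂, hZH, ?_⟩
  have hZtb : (fun q => ‖Zt q‖) =O[l] fun _ => (1 : ℝ) := by
    have h1 := bigO_mul
      (bigO_mul
      (bigO_transpose hH₁b) hZ) hA₂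
    simp only [one_mul] at h1
    refine (bigO_add (hZA.trans hdd1) h1).congr_left
      fun q => ?_
    rw [sub_add_cancel]
  -- `A₁ H₁ᵀ` is close to the identity
  have hHA : (fun q => ‖(1 : Matrix (Fin r) (Fin r) ℝ) - A₁ q * (H₁ q).transpose‖) =O[l] d := by
    have h1 := bigO_mul hH₁b hAH₁
    simp only [one_mul] at h1
    refine (h1.trans hdd).congr' (hU₁.mono fun q hq => ?_) EventuallyEq.rfl
    simp only
    rw [Matrix.mul_sub, Matrix.mul_nonsing_inv _ ((Matrix.isUnit_iff_isUnit_det _).1 hq),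
      norm_sub_rev, ← norm_transpose, Matrix.transpose_sub, Matrix.transpose_one,
      Matrix.transpose_mul, Matrix.transpose_transpose]
  have h1 := bigO_mul (bigO_mul (bigO_mul h₁₁.bounded hHA) hZ) hA₂
  have h2 := bigO_mul hwb (hAH₂t.trans hdd)
  have h3 := bigO_mul (bigO_mul h₁₁.bounded hA₁) (hZA.trans hdd)
  have h4 := bigO_mul hB₁ hZtb
  simp only [one_mul, mul_one] at h1 h2 h3 h4
  refine bigO_congr (bigO_sub (bigO_sub (bigO_add (bigO_add h1 h2) hB₂) h3) h4)
    (Eventually.of_forall fun q => ?_)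
  rw [c₁.loadings_eq, c₂.loadings_eq, hw]
  simp only [hA₁d, hA₂d, hB₁d, hB₂d, Matrix.add_mul, Matrix.mul_sub, Matrix.sub_mul,
    Matrix.mul_assoc, Matrix.one_mul]
  abel

end Break
end FactorBreak

/-! ### Second moments -/

namespace FactorBreak

attribute [local instance] Matrix.frobeniusNormedSpace

section SecondMoment

variable {Ω : Type*} [MeasurableSpace Ω] {P : Measure Ω}

theorem integrable_mul_of_sq {x y : Ω → ℝ} (hxm : Measurable x) (hym : Measurable y)
    (hx : Integrable (fun ω => x ω ^ 2) P) (hy : Integrable (fun ω => y ω ^ 2) P) :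
    Integrable (fun ω => x ω * y ω) P := by
  refine (hx.add hy).mono' (hxm.mul hym).aestronglyMeasurable (Eventually.of_forall fun ω => ?_)
  simp only [Real.norm_eq_abs, Pi.add_apply]
  refine abs_le.2 ⟨?_, ?_⟩ <;> nlinarith [sq_nonneg (x ω + y ω), sq_nonneg (x ω - y ω),
    sq_nonneg (x ω), sq_nonneg (y ω)]

theorem abs_integral_mul_le {x y : Ω → ℝ} {K : ℝ} (hxm : Measurable x) (hym : Measurable y)
    (hx : Integrable (fun ω => x ω ^ 2) P) (hy : Integrable (fun ω => y ω ^ 2) P)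
    (hxK : ∫ ω, x ω ^ 2 ∂P ≤ K) (hyK : ∫ ω, y ω ^ 2 ∂P ≤ K) : |∫ ω, x ω * y ω ∂P| ≤ K := by
  have hxy := integrable_mul_of_sq hxm hym hx hy
  calc |∫ ω, x ω * y ω ∂P| ≤ ∫ ω, |x ω * y ω| ∂P := abs_integral_le_integral_abs
    _ ≤ ∫ ω, (1 / 2 * x ω ^ 2 + 1 / 2 * y ω ^ 2) ∂P := by
        refine integral_mono hxy.abs ((hx.const_mul _).add (hy.const_mul _)) fun ω => ?_
        refine abs_le.2 ⟨?_, ?_⟩ <;> nlinarith [sq_nonneg (x ω + y ω), sq_nonneg (x ω - y ω)]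
    _ = 1 / 2 * ∫ ω, x ω ^ 2 ∂P + 1 / 2 * ∫ ω, y ω ^ 2 ∂P := by
        rw [integral_add (hx.const_mul _) (hy.const_mul _), integral_const_mul, integral_const_mul]
    _ ≤ K := by linarith

/-- Second moment of `∑ i, x i * y i` when the products `x i * x j` are independent of the products
`y i * y j`: only the sum of the absolute second moments of the `y i` enters. -/
theorem integral_sq_sum_mul_le {ι : Type*} [Fintype ι] {x y : ι → Ω → ℝ} {K : ℝ}
    (hxm : ∀ i, Measurable (x i)) (hym : ∀ i, Measurable (y i))
    (hx : ∀ i, Integrable (fun ω => x i ω ^ 2) P) (hy : ∀ i, Integrable (fun ω => y i ω ^ 2) P)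
    (hxK : ∀ i, ∫ ω, x i ω ^ 2 ∂P ≤ K)
    (hind : ∀ i j, IndepFun (fun ω => x i ω * x j ω) (fun ω => y i ω * y j ω) P) :
    Integrable (fun ω => (∑ i, x i ω * y i ω) ^ 2) P ∧
      ∫ ω, (∑ i, x i ω * y i ω) ^ 2 ∂P ≤ K * ∑ i, ∑ j, |∫ ω, y i ω * y j ω ∂P| := by
  have hxx := fun i j => integrable_mul_of_sq (hxm i) (hxm j) (hx i) (hx j)
  have hyy := fun i j => integrable_mul_of_sq (hym i) (hym j) (hy i) (hy j)
  have hprod : ∀ i j, Integrable (fun ω => (x i ω * x j ω) * (y i ω * y j ω)) P := fun i j =>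
    (hind i j).integrable_mul (hxx i j) (hyy i j)
  have heq : (fun ω => (∑ i, x i ω * y i ω) ^ 2) =
      fun ω => ∑ i, ∑ j, (x i ω * x j ω) * (y i ω * y j ω) := by
    funext ω
    rw [sq, Finset.sum_mul_sum]
    exact Finset.sum_congr rfl fun i _ => Finset.sum_congr rfl fun j _ => by ring
  have hint : ∀ i, Integrable (fun ω => ∑ j, (x i ω * x j ω) * (y i ω * y j ω)) P := fun i =>
    integrable_finsetSum _ fun j _ => hprod i j
  rw [heq]
  refine ⟨integrable_finsetSum _ fun i _ => hint i, ?_⟩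
  rw [integral_finsetSum _ fun i _ => hint i, Finset.mul_sum]
  refine Finset.sum_le_sum fun i _ => ?_
  rw [integral_finsetSum _ fun j _ => hprod i j, Finset.mul_sum]
  refine Finset.sum_le_sum fun j _ => ?_
  have h1 : ∫ ω, (x i ω * x j ω) * (y i ω * y j ω) ∂P =
      (∫ ω, x i ω * x j ω ∂P) * ∫ ω, y i ω * y j ω ∂P :=
    (hind i j).integral_mul_eq_mul_integral (hxx i j).aestronglyMeasurable
      (hyy i j).aestronglyMeasurable
  rw [h1]
  refine (le_abs_self _).trans ?_
  rw [abs_mul]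
  exact mul_le_mul_of_nonneg_right
    (abs_integral_mul_le (hxm i) (hxm j) (hx i) (hx j) (hxK i) (hxK j)) (abs_nonneg _)

theorem integrable_sq_of_pow [IsFiniteMeasure P] {x y : Ω → ℝ} {k : ℕ} (hk : 2 ≤ k)
    (hxm : Measurable x) (hxy : ∀ ω, |x ω| ≤ |y ω|)
    (hy : Integrable (fun ω => |y ω| ^ k) P) : Integrable (fun ω => x ω ^ 2) P := by
  refine ((integrable_const (1 : ℝ)).add hy).mono' (hxm.pow_const 2).aestronglyMeasurable
    (Eventually.of_forall fun ω => ?_)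
  rw [Real.norm_eq_abs, abs_pow, Pi.add_apply]
  refine (pow_le_pow_left₀ (abs_nonneg _) (hxy ω) 2).trans ?_
  rcases le_total (|y ω|) 1 with h | h
  · have : |y ω| ^ 2 ≤ 1 := pow_le_one₀ (abs_nonneg _) h
    have : 0 ≤ |y ω| ^ k := by positivity
    linarith
  · have : |y ω| ^ 2 ≤ |y ω| ^ k := pow_le_pow_right₀ h hk
    linarith

theorem integral_sq_le_of_pow [IsProbabilityMeasure P] {x y : Ω → ℝ} {k : ℕ} {M : ℝ} (hk : 2 ≤ k)
    (hxm : Measurable x) (hxy : ∀ ω, |x ω| ≤ |y ω|)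
    (hy : ExpLE P (fun ω => |y ω| ^ k) M) : ∫ ω, x ω ^ 2 ∂P ≤ 1 + M := by
  have h1 := integrable_sq_of_pow hk hxm hxy hy.1
  calc ∫ ω, x ω ^ 2 ∂P ≤ ∫ ω, (1 + |y ω| ^ k) ∂P := by
        refine integral_mono h1 ((integrable_const (1 : ℝ)).add hy.1) fun ω => ?_
        simp only
        rw [← sq_abs]
        refine (pow_le_pow_left₀ (abs_nonneg _) (hxy ω) 2).trans ?_
        rcases le_total (|y ω|) 1 with h | h
        · have : |y ω| ^ 2 ≤ 1 := pow_le_one₀ (abs_nonneg _) h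
          have : 0 ≤ |y ω| ^ k := by positivity
          linarith
        · have : |y ω| ^ 2 ≤ |y ω| ^ k := pow_le_pow_right₀ h hk
          linarith
    _ = 1 + ∫ ω, |y ω| ^ k ∂P := by
        rw [integral_add (integrable_const _) hy.1]; simp
    _ ≤ 1 + M := by linarith [hy.2]

theorem integral_norm_sq_le {ι κ : Type*} [Fintype ι] [Fintype κ] {A : Ω → Matrix ι κ ℝ}
    {c : ι → κ → ℝ} (hi : ∀ i j, Integrable (fun ω => A ω i j ^ 2) P)
    (hc : ∀ i j, ∫ ω, A ω i j ^ 2 ∂P ≤ c i j) :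
    Integrable (fun ω => ‖A ω‖ ^ 2) P ∧ ∫ ω, ‖A ω‖ ^ 2 ∂P ≤ ∑ i, ∑ j, c i j := by
  simp_rw [norm_sq_eq_sum]
  have h1 : ∀ i, Integrable (fun ω => ∑ j, A ω i j ^ 2) P := fun i =>
    integrable_finsetSum _ fun j _ => hi i j
  refine ⟨integrable_finsetSum _ fun i _ => h1 i, ?_⟩
  rw [integral_finsetSum _ fun i _ => h1 i]
  refine Finset.sum_le_sum fun i _ => ?_
  rw [integral_finsetSum _ fun j _ => hi i j]
  exact Finset.sum_le_sum fun j _ => hc i j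

end SecondMoment

theorem sum_fin_shift_le {g : ℕ → ℝ} (hg : ∀ t, 0 ≤ g t) {a n T : ℕ} (h : a + n ≤ T) :
    ∑ t : Fin n, g (a + t) ≤ ∑ t ∈ Finset.range T, g t := by
  rw [Fin.sum_univ_eq_sum_range (fun t => g (a + t)) n]
  calc ∑ t ∈ Finset.range n, g (a + t) ≤ ∑ t ∈ Finset.range (a + n), g t := by
        rw [Finset.sum_range_add]
        exact le_add_of_nonneg_left (Finset.sum_nonneg fun t _ => hg t)
    _ ≤ _ := Finset.sum_le_sum_of_subset_of_nonneg (Finset.range_mono h) fun t _ _ => hg t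

namespace Model

variable {Ω : Type*} [MeasurableSpace Ω] {P : Measure Ω} {r : ℕ}
  {D : Model Ω r} {SigF : Matrix (Fin r) (Fin r) ℝ} {SigLam : Regime → Matrix (Fin r) (Fin r) ℝ}
  {tau : ℕ → ℕ → ℝ} {M : ℝ}

theorem brk_le (h1 : D.frac < 1) (T : ℕ) : D.brk T ≤ T := by
  refine Nat.floor_le_of_le ?_
  nlinarith [Nat.cast_nonneg (α := ℝ) T]

theorem start_add_len_le (h1 : D.frac < 1) (m : Regime) (T : ℕ) :
    D.start m T + D.len m T ≤ T := by
  have := brk_le h1 T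
  cases m <;> simp only [start, len] <;> omega

theorem len_le (h1 : D.frac < 1) (m : Regime) (T : ℕ) : D.len m T ≤ T :=
  (Nat.le_add_left _ _).trans (start_add_len_le h1 m T)

theorem measurable_f_apply (t : ℕ) (j : Fin r) : Measurable fun ω => D.f t ω j := by
  have := D.measurable_f t
  fun_prop

theorem measurable_lam_apply (m : Regime) (N : ℕ) (i : Fin N) (j : Fin r) :
    Measurable fun ω => D.lam m N i ω j := by
  have := D.measurable_lam m N i
  fun_prop

/-- The σ-algebra generated by the loadings of regime `m` and the factors. -/
abbrev signalAlgebra (D : Model Ω r) (m : Regime) (N : ℕ) : MeasurableSpace Ω :=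
  MeasurableSpace.comap (fun ω (i : Fin N) => D.lam m N i ω) MeasurableSpace.pi ⊔
    MeasurableSpace.comap (fun ω (t : ℕ) => D.f t ω) MeasurableSpace.pi

theorem measurable_signal_lam (m : Regime) (N : ℕ) (i : Fin N) (j : Fin r) :
    Measurable[D.signalAlgebra m N] fun ω => D.lam m N i ω j := by
  have h : Measurable fun (v : Fin N → EuclideanSpace ℝ (Fin r)) => v i j := by fun_prop
  exact (h.comp (comap_measurable fun ω (i : Fin N) => D.lam m N i ω)).mono le_sup_left le_rfl

theorem measurable_signal_f (m : Regime) (N : ℕ) (t : ℕ) (j : Fin r) :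
    Measurable[D.signalAlgebra m N] fun ω => D.f t ω j := by
  have h : Measurable fun (v : ℕ → EuclideanSpace ℝ (Fin r)) => v t j := by fun_prop
  exact (h.comp (comap_measurable fun ω (t : ℕ) => D.f t ω)).mono le_sup_right le_rfl

theorem comap_le (m : Regime) (N : ℕ) : ∀ i : Fin 3,
    (![MeasurableSpace.comap (fun ω (i : Fin N) => D.lam m N i ω) MeasurableSpace.pi,
      MeasurableSpace.comap (fun ω (t : ℕ) => D.f t ω) MeasurableSpace.pi,
      MeasurableSpace.comap (fun ω (p : ℕ × ℕ) => D.e p.1 p.2 ω) MeasurableSpace.pi] i) ≤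
    ‹MeasurableSpace Ω› := by
  intro i
  fin_cases i
  · exact (measurable_pi_lambda _ fun i => D.measurable_lam m N i).comap_le
  · exact (measurable_pi_lambda _ fun i => D.measurable_f i).comap_le
  · exact (measurable_pi_lambda _ fun i : ℕ × ℕ => D.measurable_e i.1 i.2).comap_le

/-- The loadings of one regime and the factors are jointly independent of the errors. -/
theorem indep_signal_errors (h : D.Independent P) (m : Regime) (N : ℕ) :
    Indep (D.signalAlgebra m N)
      (MeasurableSpace.comap (fun ω (p : ℕ × ℕ) => D.e p.1 p.2 ω) MeasurableSpace.pi) P := by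
  have h1 := indep_iSup_of_disjoint (comap_le m N) (h m N) (S := {0, 1}) (T := {2}) (by simp)
  simpa [iSup_pair, signalAlgebra] using h1

theorem indepFun_signal_errors (h : D.Independent P) (m : Regime) (N : ℕ) {g : Ω → ℝ}
    (hg : Measurable[D.signalAlgebra m N] g) (i s j t : ℕ) :
    IndepFun g (fun ω => D.e i s ω * D.e j t ω) P := by
  have he : Measurable[MeasurableSpace.comap (fun ω (p : ℕ × ℕ) => D.e p.1 p.2 ω)
      MeasurableSpace.pi] fun ω => D.e i s ω * D.e j t ω := by
    have h : Measurable fun (v : ℕ × ℕ → ℝ) => v (i, s) * v (j, t) := by fun_prop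
    exact h.comp (comap_measurable fun ω (p : ℕ × ℕ) => D.e p.1 p.2 ω)
  rw [IndepFun_iff_Indep]
  exact indep_of_indep_of_le_right (indep_of_indep_of_le_left (indep_signal_errors h m N)
    hg.comap_le) he.comap_le

theorem indepFun_f_lam (h : D.Independent P) (m : Regime) (N : ℕ) (t : ℕ) (i : Fin N)
    (j k : Fin r) : IndepFun (fun ω => D.f t ω j ^ 2) (fun ω => D.lam m N i ω k ^ 2) P := by
  have h1 : Indep (MeasurableSpace.comap (fun ω (t : ℕ) => D.f t ω) MeasurableSpace.pi)
      (MeasurableSpace.comap (fun ω (i : Fin N) => D.lam m N i ω) MeasurableSpace.pi) P :=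
    (h m N).indep (i := 1) (j := 0) (by decide)
  rw [IndepFun_iff_Indep]
  have hf : Measurable fun (v : ℕ → EuclideanSpace ℝ (Fin r)) => v t j ^ 2 := by fun_prop
  have hl : Measurable fun (v : Fin N → EuclideanSpace ℝ (Fin r)) => v i k ^ 2 := by fun_prop
  exact indep_of_indep_of_le_right (indep_of_indep_of_le_left h1
    (hf.comp (comap_measurable fun ω (t : ℕ) => D.f t ω)).comap_le)
    (hl.comp (comap_measurable fun ω (i : Fin N) => D.lam m N i ω)).comap_le

theorem Errors.integrable_sq [IsProbabilityMeasure P] (h : D.Errors P tau M) (i t : ℕ) :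
    Integrable (fun ω => D.e i t ω ^ 2) P :=
  integrable_sq_of_pow (by norm_num) (D.measurable_e i t) (fun _ => le_rfl) (h.moment i t).1

theorem Errors.integral_sq_le [IsProbabilityMeasure P] (h : D.Errors P tau M) (i t : ℕ) :
    ∫ ω, D.e i t ω ^ 2 ∂P ≤ 1 + M :=
  integral_sq_le_of_pow (by norm_num) (D.measurable_e i t) (fun _ => le_rfl) (h.moment i t)

theorem Errors.nonneg (h : D.Errors P tau M) : 0 ≤ M :=
  (abs_nonneg _).trans (h.gam_diag 0 0)

theorem Errors.cross_sum_le (h : D.Errors P tau M) (N T : ℕ) :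
    ∑ i ∈ Finset.range N, ∑ j ∈ Finset.range N, ∑ t ∈ Finset.range T, ∑ s ∈ Finset.range T,
      |∫ ω, D.e i t ω * D.e j s ω ∂P| ≤ M * (N * T) := by
  rcases Nat.eq_zero_or_pos N with rfl | hN
  · simp
  rcases Nat.eq_zero_or_pos T with rfl | hT
  · simp
  have h1 := h.cross_sum N T
  rwa [inv_mul_le_iff₀ (by positivity), mul_comm] at h1

theorem abs_apply_le_norm_euclidean (v : EuclideanSpace ℝ (Fin r)) (j : Fin r) :
    |v j| ≤ |‖v‖| := by
  rw [abs_norm]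
  exact PiLp.norm_apply_le v j

theorem Factors.integrable_sq [IsProbabilityMeasure P] (h : D.Factors P SigF) (t : ℕ) (j : Fin r) :
    Integrable (fun ω => D.f t ω j ^ 2) P :=
  integrable_sq_of_pow (y := fun ω => ‖D.f t ω‖) (k := 4) (by norm_num) (measurable_f_apply t j)
    (fun _ => abs_apply_le_norm_euclidean _ j) (by simpa using h.moment t)

theorem Factors.integral_sq (h : D.Factors P SigF) (t : ℕ) (j : Fin r) :
    ∫ ω, D.f t ω j ^ 2 ∂P = SigF j j := by
  simpa only [sq] using h.second t j j

theorem Factors.diag_nonneg (h : D.Factors P SigF) (j : Fin r) : 0 ≤ SigF j j := by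
  rw [← h.integral_sq 0 j]
  exact integral_nonneg fun ω => sq_nonneg _

theorem Loadings.integrable_sq [IsProbabilityMeasure P] (h : D.Loadings P SigLam M) (m : Regime)
    (N : ℕ) (i : Fin N) (j : Fin r) : Integrable (fun ω => D.lam m N i ω j ^ 2) P :=
  integrable_sq_of_pow (y := fun ω => ‖D.lam m N i ω‖) (k := 4) (by norm_num)
    (measurable_lam_apply m N i j)
    (fun _ => abs_apply_le_norm_euclidean _ j) (by simpa using (h.moment m N i).1)

theorem Loadings.integral_sq_le [IsProbabilityMeasure P] (h : D.Loadings P SigLam M) (m : Regime)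
    (N : ℕ) (i : Fin N) (j : Fin r) : ∫ ω, D.lam m N i ω j ^ 2 ∂P ≤ 1 + M :=
  integral_sq_le_of_pow (y := fun ω => ‖D.lam m N i ω‖) (k := 4) (by norm_num)
    (measurable_lam_apply m N i j)
    (fun _ => abs_apply_le_norm_euclidean _ j) (by simpa using h.moment m N i)

theorem eventually_pos : ∀ᶠ p : ℕ × ℕ in atTop, 0 < (p.1 : ℝ) * p.2 := by
  filter_upwards [eventually_ge_atTop ((1, 1) : ℕ × ℕ)] with p hp
  have h1 : 0 < p.1 := hp.1
  have h2 : 0 < p.2 := hp.2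
  positivity

/-- An entry of the Gram matrix of the errors splits into its mean `N γ_N(s, t)` and a centred part
whose second moment is of order `N`. -/
theorem Errors.gram_entry [IsProbabilityMeasure P] (he : D.Errors P tau M) (N s t : ℕ) :
    Integrable (fun ω => (∑ i ∈ Finset.range N, D.e i s ω * D.e i t ω) ^ 2) P ∧
      ∫ ω, (∑ i ∈ Finset.range N, D.e i s ω * D.e i t ω) ^ 2 ∂P ≤
        2 * (N * D.gam P N s t) ^ 2 + 2 * (N * (1 + M)) := by
  have hee : ∀ i, Integrable (fun ω => D.e i s ω * D.e i t ω) P := fun i =>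
    integrable_mul_of_sq (D.measurable_e i s) (D.measurable_e i t) (he.integrable_sq i s)
      (he.integrable_sq i t)
  have hsplit : ∀ ω, ∑ i ∈ Finset.range N, D.e i s ω * D.e i t ω =
      N * D.gam P N s t + ∑ i ∈ Finset.range N, D.cov P i s t ω := by
    intro ω
    rcases Nat.eq_zero_or_pos N with rfl | hN
    · simp
    have hN' : (N : ℝ) ≠ 0 := by exact_mod_cast hN.ne'
    rw [gam, integral_const_mul, mul_inv_cancel_left₀ hN', integral_finsetSum _ fun i _ => hee i,
      ← Finset.sum_add_distrib]
    exact Finset.sum_congr rfl fun i _ => by rw [cov]; ring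
  have hcov : ∀ ω, (∑ i ∈ Finset.range N, D.cov P i s t ω) ^ 2 ≤
      N * (1 + |(Real.sqrt N)⁻¹ * ∑ i ∈ Finset.range N, D.cov P i s t ω| ^ 4) := by
    intro ω
    set v := ∑ i ∈ Finset.range N, D.cov P i s t ω with hv
    rcases Nat.eq_zero_or_pos N with rfl | hN
    · simp [hv]
    have hN' : (0 : ℝ) < N := by exact_mod_cast hN
    have h2 : v ^ 2 = N * ((Real.sqrt N)⁻¹ * v) ^ 2 := by
      rw [mul_pow, inv_pow, Real.sq_sqrt hN'.le, mul_inv_cancel_left₀ hN'.ne']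
    rw [h2, show |(Real.sqrt N)⁻¹ * v| ^ 4 = (((Real.sqrt N)⁻¹ * v) ^ 2) ^ 2 by
      rw [← sq_abs ((Real.sqrt N)⁻¹ * v)]; ring]
    gcongr
    nlinarith [sq_nonneg (((Real.sqrt N)⁻¹ * v) ^ 2 - 1), sq_nonneg ((Real.sqrt N)⁻¹ * v)]
  have hbound : ∀ ω, (∑ i ∈ Finset.range N, D.e i s ω * D.e i t ω) ^ 2 ≤
      2 * (N * D.gam P N s t) ^ 2 + 2 * (N *
        (1 + |(Real.sqrt N)⁻¹ * ∑ i ∈ Finset.range N, D.cov P i s t ω| ^ 4)) := by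
    intro ω
    rw [hsplit]
    nlinarith [hcov ω, sq_nonneg (N * D.gam P N s t -
      ∑ i ∈ Finset.range N, D.cov P i s t ω)]
  have hintc : Integrable (fun ω => 2 * ((N : ℝ) *
      (1 + |(Real.sqrt N)⁻¹ * ∑ i ∈ Finset.range N, D.cov P i s t ω| ^ 4))) P :=
    (((integrable_const (1 : ℝ)).add (he.fourth N t s).1).const_mul (N : ℝ)).const_mul 2
  have hdom : Integrable (fun ω => 2 * (N * D.gam P N s t) ^ 2 + 2 * ((N : ℝ) *
      (1 + |(Real.sqrt N)⁻¹ * ∑ i ∈ Finset.range N, D.cov P i s t ω| ^ 4))) P :=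
    (integrable_const _).add hintc
  have hI : Integrable (fun ω => (∑ i ∈ Finset.range N, D.e i s ω * D.e i t ω) ^ 2) P :=
    hdom.mono'
      ((Finset.measurable_sum _ fun i _ =>
        (D.measurable_e _ _).mul (D.measurable_e _ _)).pow_const 2).aestronglyMeasurable
      (Eventually.of_forall fun ω => by
        rw [Real.norm_of_nonneg (sq_nonneg _)]; exact hbound ω)
  refine ⟨hI, (integral_mono hI hdom hbound).trans ?_⟩
  rw [integral_add (integrable_const _) hintc, integral_const, integral_const_mul,
    integral_const_mul, integral_add (integrable_const _) (he.fourth N t s).1]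
  have := (he.fourth N t s).2
  simp only [integral_const, probReal_univ, smul_eq_mul, one_mul]
  gcongr

theorem ErrorRows.sum_gam_sq_le (hr : D.ErrorRows P tau M) (N T s : ℕ) (hs : s < T) :
    ∑ t ∈ Finset.range T, D.gam P N s t ^ 2 ≤ M ^ 2 := by
  have hM : 0 ≤ M := (Finset.sum_nonneg fun _ _ => abs_nonneg _).trans (hr.gam_row N T s hs)
  calc ∑ t ∈ Finset.range T, D.gam P N s t ^ 2
      ≤ ∑ t ∈ Finset.range T, M * |D.gam P N t s| := by
        refine Finset.sum_le_sum fun t ht => ?_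
        have hsymm : D.gam P N s t = D.gam P N t s := by
          simp only [gam, mul_comm (D.e _ s _)]
        have hle1 : |D.gam P N t s| ≤ M :=
          (Finset.single_le_sum (f := fun t => |D.gam P N t s|) (fun _ _ => abs_nonneg _)
            ht).trans (hr.gam_row N T s hs)
        rw [hsymm, ← sq_abs (D.gam P N t s), sq |D.gam P N t s|]
        exact mul_le_mul_of_nonneg_right hle1 (abs_nonneg _)
    _ = M * ∑ t ∈ Finset.range T, |D.gam P N t s| := by rw [Finset.mul_sum]
    _ ≤ M * M := mul_le_mul_of_nonneg_left (hr.gam_row N T s hs) hM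
    _ = _ := by ring

variable [IsProbabilityMeasure P] (h1 : D.frac < 1)
include h1

theorem isBigOp_err (he : D.Errors P tau M) (m : Regime) :
    IsBigOp P (fun N T ω => ‖D.err m N T ω‖ ^ 2) (fun N T => (N : ℝ) * T) := by
  have key := fun N T => integral_norm_sq_le (P := P) (A := fun ω => D.err m N T ω)
    (c := fun _ _ => 1 + M)
    (fun t i => he.integrable_sq i (D.start m T + t))
    (fun t i => he.integral_sq_le i (D.start m T + t))
  refine isBigOp_of_integral_le (1 + M) (fun N T ω => sq_nonneg _) (fun N T => (key N T).1)
    (fun N T => (key N T).2.trans ?_) eventually_pos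
  simp only [Finset.sum_const, Finset.card_univ, Fintype.card_fin, nsmul_eq_mul]
  have h2 : (D.len m T : ℝ) ≤ T := by
    exact_mod_cast len_le h1 m T
  have h3 := he.nonneg
  calc (D.len m T : ℝ) * (N * (1 + M)) ≤ T * (N * (1 + M)) := by gcongr
    _ = _ := by ring

theorem isBigOp_factors_err (hf : D.Factors P SigF) (he : D.Errors P tau M)
    (hi : D.Independent P) (m : Regime) :
    IsBigOp P (fun N T ω => ‖(D.F m T ω).transpose * D.err m N T ω‖ ^ 2)
      (fun N T => (N : ℝ) * T) := by
  have key := fun N T => integral_norm_sq_le (P := P)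
    (A := fun ω => (D.F m T ω).transpose * D.err m N T ω)
    (c := fun j k => SigF j j * ∑ s : Fin (D.len m T), ∑ t : Fin (D.len m T),
      |∫ ω, D.e k (D.start m T + s) ω * D.e k (D.start m T + t) ω ∂P|)
    (fun j k => (integral_sq_sum_mul_le (K := SigF j j)
      (fun s : Fin (D.len m T) => measurable_f_apply (D.start m T + s) j)
      (fun s : Fin (D.len m T) => D.measurable_e k (D.start m T + s))
      (fun _ => hf.integrable_sq _ _) (fun _ => he.integrable_sq _ _)
      (fun _ => (hf.integral_sq _ _).le)
      (fun _ _ => indepFun_signal_errors hi m N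
        ((measurable_signal_f m N _ _).mul (measurable_signal_f m N _ _)) _ _ _ _)).1)
    (fun j k => (integral_sq_sum_mul_le (K := SigF j j)
      (fun s : Fin (D.len m T) => measurable_f_apply (D.start m T + s) j)
      (fun s : Fin (D.len m T) => D.measurable_e k (D.start m T + s))
      (fun _ => hf.integrable_sq _ _) (fun _ => he.integrable_sq _ _)
      (fun _ => (hf.integral_sq _ _).le)
      (fun _ _ => indepFun_signal_errors hi m N
        ((measurable_signal_f m N _ _).mul (measurable_signal_f m N _ _)) _ _ _ _)).2)
  refine isBigOp_of_integral_le ((∑ j, SigF j j) * M) (fun N T ω => sq_nonneg _)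
    (fun N T => (key N T).1) (fun N T => (key N T).2.trans ?_) eventually_pos
  rw [mul_assoc, Finset.sum_mul]
  refine Finset.sum_le_sum fun j _ => ?_
  rw [← Finset.mul_sum]
  refine mul_le_mul_of_nonneg_left (le_trans ?_ (he.cross_sum_le N T)) (hf.diag_nonneg j)
  rw [Fin.sum_univ_eq_sum_range (fun k => ∑ s : Fin (D.len m T), ∑ t : Fin (D.len m T),
      |∫ ω, D.e k (D.start m T + s) ω * D.e k (D.start m T + t) ω ∂P|)]
  refine Finset.sum_le_sum fun k hk => ?_
  refine le_trans ?_ (Finset.single_le_sum (f := fun j => ∑ t ∈ Finset.range T,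
    ∑ s ∈ Finset.range T, |∫ ω, D.e k t ω * D.e j s ω ∂P|)
    (fun j _ => Finset.sum_nonneg fun t _ => Finset.sum_nonneg fun s _ => abs_nonneg _) hk)
  have hT := start_add_len_le h1 m T
  refine le_trans (Finset.sum_le_sum fun s _ => sum_fin_shift_le
    (g := fun t => |∫ ω, D.e k (D.start m T + s) ω * D.e k t ω ∂P|) (fun _ => abs_nonneg _) hT) ?_
  exact sum_fin_shift_le (g := fun s => ∑ t ∈ Finset.range T, |∫ ω, D.e k s ω * D.e k t ω ∂P|)
    (fun _ => Finset.sum_nonneg fun t _ => abs_nonneg _) hT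

/-- The regime `m'` of the loadings is arbitrary: the bound comes from independence and the
summability of the error covariances, and so also covers the loadings of the other regime. -/
theorem isBigOp_factors_err_loadings (hf : D.Factors P SigF) (hl : D.Loadings P SigLam M)
    (he : D.Errors P tau M) (hi : D.Independent P) (m m' : Regime) :
    IsBigOp P (fun N T ω => ‖(D.F m T ω).transpose * D.err m N T ω * D.Lam m' N ω‖ ^ 2)
      (fun N T => (N : ℝ) * T) := by
  have hM := he.nonneg
  have hxI : ∀ N (t : ℕ) (k : Fin N) (i j : Fin r),
      Integrable (fun ω => (D.f t ω i * D.lam m' N k ω j) ^ 2) P := fun N t k i j => by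
    simp only [mul_pow]
    exact (indepFun_f_lam hi m' N t k i j).integrable_mul (hf.integrable_sq t i)
      (hl.integrable_sq m' N k j)
  have hxK : ∀ N (t : ℕ) (k : Fin N) (i j : Fin r),
      ∫ ω, (D.f t ω i * D.lam m' N k ω j) ^ 2 ∂P ≤ SigF i i * (1 + M) := fun N t k i j => by
    simp only [mul_pow]
    have h2 : ∫ ω, D.f t ω i ^ 2 * D.lam m' N k ω j ^ 2 ∂P =
        (∫ ω, D.f t ω i ^ 2 ∂P) * ∫ ω, D.lam m' N k ω j ^ 2 ∂P :=
      (indepFun_f_lam hi m' N t k i j).integral_mul_eq_mul_integral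
        (hf.integrable_sq t i).aestronglyMeasurable (hl.integrable_sq m' N k j).aestronglyMeasurable
    rw [h2, hf.integral_sq]
    exact mul_le_mul_of_nonneg_left (hl.integral_sq_le m' N k j) (hf.diag_nonneg i)
  have hent : ∀ N T ω i j, ((D.F m T ω).transpose * D.err m N T ω * D.Lam m' N ω) i j =
      ∑ p : Fin (D.len m T) × Fin N, (D.f (D.start m T + p.1) ω i * D.lam m' N p.2 ω j) *
        D.e p.2 (D.start m T + p.1) ω := fun N T ω i j => by
    rw [Fintype.sum_prod_type_right, Matrix.mul_apply]
    refine Finset.sum_congr rfl fun k _ => ?_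
    rw [Matrix.mul_apply, Finset.sum_mul]
    refine Finset.sum_congr rfl fun t _ => ?_
    simp only [Matrix.transpose_apply, F, err, Lam, Matrix.of_apply]
    ring
  have hent2 := fun N T i j => integral_sq_sum_mul_le (P := P)
    (x := fun (p : Fin (D.len m T) × Fin N) ω =>
      D.f (D.start m T + p.1) ω i * D.lam m' N p.2 ω j)
    (y := fun p ω => D.e p.2 (D.start m T + p.1) ω) (K := SigF i i * (1 + M))
    (fun p => (measurable_f_apply _ _).mul (measurable_lam_apply _ _ _ _))
    (fun p => D.measurable_e _ _) (fun p => hxI _ _ _ _ _) (fun p => he.integrable_sq _ _)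
    (fun p => hxK _ _ _ _ _) (fun p p' => indepFun_signal_errors hi m' N
      (((measurable_signal_f m' N _ _).mul (measurable_signal_lam m' N _ _)).mul
      ((measurable_signal_f m' N _ _).mul (measurable_signal_lam m' N _ _))) _ _ _ _)
  have key := fun N T => integral_norm_sq_le (P := P)
    (A := fun ω => (D.F m T ω).transpose * D.err m N T ω * D.Lam m' N ω)
    (fun i j => by simp only [hent]; exact (hent2 N T i j).1)
    (fun i j => by simp only [hent]; exact (hent2 N T i j).2)
  refine isBigOp_of_integral_le ((∑ i : Fin r, ∑ _j : Fin r, SigF i i * (1 + M)) * M)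
    (fun N T ω => sq_nonneg _) (fun N T => (key N T).1) (fun N T => (key N T).2.trans ?_)
    eventually_pos
  rw [mul_assoc, Finset.sum_mul]
  refine Finset.sum_le_sum fun i _ => ?_
  rw [Finset.sum_mul]
  refine Finset.sum_le_sum fun j _ => ?_
  refine mul_le_mul_of_nonneg_left (le_trans ?_ (he.cross_sum_le N T))
    (mul_nonneg (hf.diag_nonneg i) (by linarith))
  have hT := start_add_len_le h1 m T
  rw [Fintype.sum_prod_type_right]
  rw [Fin.sum_univ_eq_sum_range (fun k => ∑ s : Fin (D.len m T), ∑ p : Fin (D.len m T) × Fin N,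
      |∫ ω, D.e k (D.start m T + s) ω * D.e p.2 (D.start m T + p.1) ω ∂P|)]
  refine Finset.sum_le_sum fun k _ => ?_
  simp_rw [Fintype.sum_prod_type_right]
  rw [Finset.sum_comm]
  rw [Fin.sum_univ_eq_sum_range (fun k' => ∑ s : Fin (D.len m T), ∑ t : Fin (D.len m T),
      |∫ ω, D.e k (D.start m T + s) ω * D.e k' (D.start m T + t) ω ∂P|)]
  refine Finset.sum_le_sum fun k' _ => ?_
  refine le_trans (Finset.sum_le_sum fun s _ => sum_fin_shift_le
    (g := fun t => |∫ ω, D.e k (D.start m T + s) ω * D.e k' t ω ∂P|) (fun _ => abs_nonneg _) hT) ?_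
  exact sum_fin_shift_le (g := fun s => ∑ t ∈ Finset.range T, |∫ ω, D.e k s ω * D.e k' t ω ∂P|)
    (fun _ => Finset.sum_nonneg fun t _ => abs_nonneg _) hT

theorem isBigOp_err_loadings (he : D.Errors P tau M) (hm : D.Moments P M) (m m' : Regime) :
    IsBigOp P (fun N T ω => ‖D.err m N T ω * D.Lam m' N ω‖ ^ 2) (fun N T => (N : ℝ) * T) := by
  have hM := he.nonneg
  have hrow : ∀ (N t : ℕ) (ω : Ω), ‖∑ i : Fin N, D.e i t ω • D.lam m' N i ω‖ ^ 2 ≤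
      N * (1 + ‖(Real.sqrt N)⁻¹ • ∑ i : Fin N, D.e i t ω • D.lam m' N i ω‖ ^ 4) := by
    intro N t ω
    -- the bound on fourth moments is used through `y ^ 2 ≤ 1 + y ^ 4`;
    -- for `N = 0` both sides vanish
    set v := ∑ i : Fin N, D.e i t ω • D.lam m' N i ω with hv
    rcases Nat.eq_zero_or_pos N with rfl | hN
    · simp [hv]
    have hN' : (0 : ℝ) < N := by exact_mod_cast hN
    have h2 : ‖v‖ ^ 2 = N * ‖(Real.sqrt N)⁻¹ • v‖ ^ 2 := by
      rw [norm_smul, mul_pow, norm_inv, Real.norm_eq_abs, inv_pow, sq_abs, Real.sq_sqrt hN'.le,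
        mul_inv_cancel_left₀ hN'.ne']
    rw [h2]
    gcongr
    nlinarith [sq_nonneg (‖(Real.sqrt N)⁻¹ • v‖ ^ 2 - 1), sq_nonneg ‖(Real.sqrt N)⁻¹ • v‖]
  have hentry : ∀ N T ω (t : Fin (D.len m T)) j, ((D.err m N T ω * D.Lam m' N ω) t j) ^ 2 ≤
      N * (1 +
        ‖(Real.sqrt N)⁻¹ • ∑ i : Fin N, D.e i (D.start m T + t) ω • D.lam m' N i ω‖ ^ 4) := by
    intro N T ω t j
    refine le_trans ?_ (hrow N (D.start m T + t) ω)
    have h2 : (D.err m N T ω * D.Lam m' N ω) t j =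
        (∑ i : Fin N, D.e i (D.start m T + t) ω • D.lam m' N i ω) j := by
      simp [Matrix.mul_apply, err, Lam]
    rw [h2, ← sq_abs]
    exact pow_le_pow_left₀ (abs_nonneg _)
      ((abs_apply_le_norm_euclidean _ j).trans (abs_norm _).le) 2
  have hint : ∀ N t : ℕ, Integrable (fun ω => (N : ℝ) *
      (1 + ‖(Real.sqrt N)⁻¹ • ∑ i : Fin N, D.e i t ω • D.lam m' N i ω‖ ^ 4)) P := fun N t =>
    ((integrable_const (1 : ℝ)).add (hm.third m' N t).1).const_mul (N : ℝ)
  have hmeas : ∀ N T (t : Fin (D.len m T)) j,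
      Measurable fun ω => ((D.err m N T ω * D.Lam m' N ω) t j) ^ 2 := fun N T t j => by
    simp only [Matrix.mul_apply, err, Lam, Matrix.of_apply]
    exact (Finset.measurable_sum _ fun i _ =>
      (D.measurable_e _ _).mul (measurable_lam_apply _ _ _ _)).pow_const 2
  have hI : ∀ N T (t : Fin (D.len m T)) j,
      Integrable (fun ω => ((D.err m N T ω * D.Lam m' N ω) t j) ^ 2) P := fun N T t j =>
    (hint N (D.start m T + t)).mono' (hmeas N T t j).aestronglyMeasurable
      (Eventually.of_forall fun ω => by
        rw [Real.norm_of_nonneg (sq_nonneg _)]; exact hentry N T ω t j)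
  have key := fun N T => integral_norm_sq_le (P := P)
    (A := fun ω => D.err m N T ω * D.Lam m' N ω) (c := fun _ _ => N * (1 + M)) (hI N T)
    (fun t j => by
      refine (integral_mono (hI N T t j) (hint N (D.start m T + t)) fun ω =>
        hentry N T ω t j).trans ?_
      rw [integral_const_mul, integral_add (integrable_const _) (hm.third m' N _).1]
      have := (hm.third m' N (D.start m T + t)).2
      simp only [integral_const, probReal_univ, smul_eq_mul, one_mul]
      gcongr)
  refine isBigOp_of_integral_le (r * (1 + M)) (fun N T ω => sq_nonneg _) (fun N T => (key N T).1)
    (fun N T => (key N T).2.trans ?_) eventually_pos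
  simp only [Finset.sum_const, Finset.card_univ, Fintype.card_fin, nsmul_eq_mul]
  have h2 : (D.len m T : ℝ) ≤ T := by
    exact_mod_cast len_le h1 m T
  calc (D.len m T : ℝ) * (r * (N * (1 + M))) ≤ T * (r * (N * (1 + M))) := by gcongr
    _ = _ := by ring

theorem isBigOp_err_gram (he : D.Errors P tau M) (hr : D.ErrorRows P tau M) (m : Regime) :
    IsBigOp P (fun N T ω => ‖D.err m N T ω * (D.err m N T ω).transpose‖ ^ 2)
      (fun N T => (N : ℝ) ^ 2 * T + N * T ^ 2) := by
  have hM := he.nonneg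
  have hent : ∀ N T ω (s t : Fin (D.len m T)),
      (D.err m N T ω * (D.err m N T ω).transpose) s t =
        ∑ i ∈ Finset.range N, D.e i (D.start m T + s) ω * D.e i (D.start m T + t) ω := by
    intro N T ω s t
    rw [Matrix.mul_apply, ← Fin.sum_univ_eq_sum_range
      (fun i => D.e i (D.start m T + s) ω * D.e i (D.start m T + t) ω)]
    rfl
  have key := fun N T => integral_norm_sq_le (P := P)
    (A := fun ω => D.err m N T ω * (D.err m N T ω).transpose)
    (fun s t => by simp only [hent]; exact (he.gram_entry N _ _).1) 
    (fun s t => by simp only [hent]; exact (he.gram_entry N _ _).2)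
  refine isBigOp_of_integral_le (2 * M ^ 2 + 2 * (1 + M)) (fun N T ω => sq_nonneg _)
    (fun N T => (key N T).1) (fun N T => (key N T).2.trans ?_) ?_
  · have hT := start_add_len_le h1 m T
    have hrow : ∀ s ∈ Finset.range T, ∑ t ∈ Finset.range T,
        (2 * ((N : ℝ) * D.gam P N s t) ^ 2 + 2 * (N * (1 + M))) ≤
        2 * M ^ 2 * N ^ 2 + T * (2 * (N * (1 + M))) := by
      intro s hs
      rw [Finset.sum_add_distrib, Finset.sum_const, Finset.card_range, nsmul_eq_mul]
      gcongr
      calc ∑ t ∈ Finset.range T, 2 * ((N : ℝ) * D.gam P N s t) ^ 2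
          = 2 * N ^ 2 * ∑ t ∈ Finset.range T, D.gam P N s t ^ 2 := by
            rw [Finset.mul_sum]
            exact Finset.sum_congr rfl fun t _ => by ring
        _ ≤ 2 * N ^ 2 * M ^ 2 := by
            gcongr
            exact hr.sum_gam_sq_le N T s (Finset.mem_range.1 hs)
        _ = _ := by ring
    refine le_trans (Finset.sum_le_sum fun s _ => sum_fin_shift_le (g := fun t =>
      2 * ((N : ℝ) * D.gam P N (D.start m T + s) t) ^ 2 + 2 * (N * (1 + M)))
      (fun _ => by positivity) hT) ?_
    refine le_trans (sum_fin_shift_le (g := fun s => ∑ t ∈ Finset.range T,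
      (2 * ((N : ℝ) * D.gam P N s t) ^ 2 + 2 * (N * (1 + M))))
      (fun _ => Finset.sum_nonneg fun _ _ => by positivity) hT) ?_
    refine (Finset.sum_le_sum hrow).trans ?_
    rw [Finset.sum_const, Finset.card_range, nsmul_eq_mul]
    -- the means contribute `N² T`, the centred parts `N T²`
    have e1 : 0 ≤ (N : ℝ) ^ 2 * T * (2 * (1 + M)) := by positivity
    have e2 : 0 ≤ (N : ℝ) * T ^ 2 * (2 * M ^ 2) := by positivity
    nlinarith
  · filter_upwards [eventually_pos] with p hp
    have h2 : (0 : ℝ) < p.1 := by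
      rcases (Nat.cast_nonneg (α := ℝ) p.1).eq_or_lt with h | h
      · rw [← h, zero_mul] at hp; exact absurd hp (lt_irrefl _)
      · exact h
    have h3 : 0 < (p.1 : ℝ) * p.2 * (p.1 + p.2) := mul_pos hp (by positivity)
    linarith [h3]

end Model
end FactorBreak

/-! ### Normalization -/

namespace FactorBreak

attribute [local instance] Matrix.frobeniusNormedSpace

open Asymptotics

section EigenvalueBound

variable {α : Type*} {l : Filter α} {r : ℕ} {n N : α → ℕ} {d : α → ℝ}
  {f : ∀ q, Matrix (Fin (n q)) (Fin r) ℝ} {u : ∀ q, Matrix (Fin (n q)) (Fin (N q)) ℝ}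
  {lam : ∀ q, Matrix (Fin (N q)) (Fin r) ℝ} {x X : ∀ q, Matrix (Fin (n q)) (Fin (N q)) ℝ}

/-- In a factor model the quadratic form of the Gram matrix on the span of the factors converges to
`SigF * SigL * SigF`, so the `r` largest eigenvalues stay away from zero. -/
theorem exists_eventually_le_topEigenvalues_of_factor_model {SigF SigL : Matrix (Fin r) (Fin r) ℝ}
    (hF : SigF.PosDef) (hL : SigL.PosDef) (hn : ∀ᶠ q in l, r ≤ n q) (hd : Tendsto d l (𝓝 0))
    (hx : ∀ q, x q = f q * (lam q).transpose + u q)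
    (hX : ∀ q, scaledGram (X q) = x q * (x q).transpose)
    (hP : Tendsto (fun q => (f q).transpose * f q) l (𝓝 SigF))
    (hG : Tendsto (fun q => (lam q).transpose * lam q) l (𝓝 SigL))
    (hfu : (fun q => ‖(f q).transpose * u q‖) =O[l] d)
    (hful : (fun q => ‖(f q).transpose * u q * lam q‖) =O[l] fun q => d q * d q) :
    ∃ c : ℝ, 0 < c ∧ ∀ᶠ q in l, ∀ j, c ≤ topEigenvalues r (X q) j := by
  have hS : (SigF * SigL * SigF).PosDef := by
    have h1 := hL.conjTranspose_mul_mul_same (B := SigF)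
      (Matrix.mulVec_injective_of_isUnit hF.isUnit)
    rwa [hF.isHermitian] at h1
  have hd2 : Tendsto (fun q => d q * d q) l (𝓝 0) := by simpa using hd.mul hd
  refine exists_eventually_le_topEigenvalues (F := f) hS hF hn ?_ ?_
  · simpa using (hP.sub_const SigF).norm
  · have h1 : Tendsto (fun q => ‖(f q).transpose * f q * ((lam q).transpose * lam q) *
        ((f q).transpose * f q) - SigF * SigL * SigF‖) l (𝓝 0) := by
      simpa using (((hP.mul hG).mul hP).sub_const (SigF * SigL * SigF)).norm
    have hP1 := bigO_one_of_tendsto hP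
    have h2 := bigO_mul hful hP1
    have h3 := bigO_mul hP1 (bigO_transpose hful)
    have h4 := bigO_mul hfu (bigO_transpose hfu)
    simp only [mul_one, one_mul] at h2 h3
    have h5 := ((bigO_add (bigO_add h2 h3) h4).trans_tendsto hd2).add h1
    rw [add_zero] at h5
    refine squeeze_zero (fun _ => norm_nonneg _) (fun q => ?_) h5
    refine le_trans (le_of_eq ?_) (norm_add_le _ _)
    congr 1
    rw [hX, hx]
    simp only [Matrix.transpose_add, Matrix.transpose_mul, Matrix.transpose_transpose,
      Matrix.add_mul, Matrix.mul_add, Matrix.mul_assoc]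
    abel

end EigenvalueBound

/-- The projection coefficient does not change when both loadings matrices are rescaled. -/
theorem projCoef_smul {N r : ℕ} {k : ℝ} (hk : k ≠ 0) (L₁ L₂ : Matrix (Fin N) (Fin r) ℝ)
    (hu : IsUnit (L₁.transpose * L₁)) : projCoef (k • L₁) (k • L₂) = projCoef L₁ L₂ := by
  have h1 : ((k • L₁).transpose * (k • L₁))⁻¹ = (k * k)⁻¹ • (L₁.transpose * L₁)⁻¹ := by
    refine Matrix.inv_eq_left_inv ?_
    simp only [Matrix.transpose_smul, Matrix.smul_mul, Matrix.mul_smul, smul_smul,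
      Matrix.nonsing_inv_mul _ ((Matrix.isUnit_iff_isUnit_det _).1 hu)]
    rw [mul_inv_cancel₀ (mul_ne_zero hk hk), one_smul]
  rw [projCoef, projCoef, h1, Matrix.transpose_smul]
  simp only [Matrix.smul_mul, Matrix.mul_smul, smul_smul]
  rw [show k * (k * (k * k)⁻¹) = 1 by field_simp, one_smul]

theorem inv_sqrt_mul_self (N : ℕ) : (Real.sqrt N)⁻¹ * (Real.sqrt N)⁻¹ = (N : ℝ)⁻¹ := by
  rw [← mul_inv, Real.mul_self_sqrt (Nat.cast_nonneg N)]

section JointLimit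

variable {Ω : Type*} {l : Filter ((ℕ × ℕ) × Ω)}

/-- `1 / δ_{NT}` as a function of `((N, T), ω)`. -/
noncomputable def invDelta (q : (ℕ × ℕ) × Ω) : ℝ := (delta q.1.1 q.1.2)⁻¹

variable (hl : Tendsto Prod.fst l atTop)
include hl

theorem tendsto_N : Tendsto (fun q : (ℕ × ℕ) × Ω => q.1.1) l atTop :=
  tendsto_fst.comp (by simpa [prod_atTop_atTop_eq] using hl :
    Tendsto Prod.fst l (atTop ×ˢ atTop))

theorem tendsto_T : Tendsto (fun q : (ℕ × ℕ) × Ω => q.1.2) l atTop :=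
  tendsto_snd.comp (by simpa [prod_atTop_atTop_eq] using hl :
    Tendsto Prod.fst l (atTop ×ˢ atTop))

theorem tendsto_sqrt_N : Tendsto (fun q : (ℕ × ℕ) × Ω => Real.sqrt q.1.1) l atTop :=
  Real.tendsto_sqrt_atTop.comp (tendsto_natCast_atTop_atTop.comp (tendsto_N hl))

theorem tendsto_sqrt_T : Tendsto (fun q : (ℕ × ℕ) × Ω => Real.sqrt q.1.2) l atTop :=
  Real.tendsto_sqrt_atTop.comp (tendsto_natCast_atTop_atTop.comp (tendsto_T hl))

theorem tendsto_invDelta : Tendsto invDelta l (𝓝 0) := by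
  refine tendsto_inv_atTop_zero.comp (tendsto_atTop.2 fun b => ?_)
  filter_upwards [(tendsto_sqrt_N hl).eventually_ge_atTop b,
    (tendsto_sqrt_T hl).eventually_ge_atTop b] with q h1 h2
  exact le_min h1 h2

theorem eventually_delta_pos : ∀ᶠ q in l, 0 < delta q.1.1 q.1.2 := by
  filter_upwards [(tendsto_sqrt_N hl).eventually_gt_atTop 0,
    (tendsto_sqrt_T hl).eventually_gt_atTop 0] with q h1 h2
  exact lt_min h1 h2

theorem inv_sqrt_N_isBigO :
    (fun q : (ℕ × ℕ) × Ω => (Real.sqrt q.1.1)⁻¹) =O[l] invDelta := by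
  refine IsBigO.of_bound 1 ((eventually_delta_pos hl).mono fun q hq => ?_)
  rw [one_mul, invDelta, Real.norm_of_nonneg (by positivity), Real.norm_of_nonneg (by positivity)]
  exact inv_anti₀ hq (min_le_left _ _)

theorem inv_sqrt_T_isBigO :
    (fun q : (ℕ × ℕ) × Ω => (Real.sqrt q.1.2)⁻¹) =O[l] invDelta := by
  refine IsBigO.of_bound 1 ((eventually_delta_pos hl).mono fun q hq => ?_)
  rw [one_mul, invDelta, Real.norm_of_nonneg (by positivity), Real.norm_of_nonneg (by positivity)]
  exact inv_anti₀ hq (min_le_right _ _)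

end JointLimit

instance : Fintype Regime :=
  ⟨⟨([Regime.pre, Regime.post] : List Regime), by simp⟩, fun m => by cases m <;> simp⟩

namespace Model

variable {Ω : Type*} [MeasurableSpace Ω] {P : Measure Ω} {r : ℕ}
  {D : Model Ω r} {SigF : Matrix (Fin r) (Fin r) ℝ} {SigLam : Regime → Matrix (Fin r) (Fin r) ℝ}
  {tau : ℕ → ℕ → ℝ} {M : ℝ}

/-- Both regimes have length of order `T`. -/
theorem exists_mul_le_len (h0 : 0 < D.frac) (h1 : D.frac < 1) (m : Regime) :
    ∃ c : ℝ, 0 < c ∧ ∀ᶠ T : ℕ in atTop, c * T ≤ D.len m T := by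
  cases m
  · refine ⟨D.frac / 2, by positivity, ?_⟩
    filter_upwards [tendsto_natCast_atTop_atTop.eventually_ge_atTop (2 / D.frac)] with T hT
    have h2 := Nat.lt_floor_add_one (D.frac * (T : ℝ))
    rw [div_le_iff₀ h0] at hT
    simp only [len, brk]
    linarith
  · refine ⟨1 - D.frac, by linarith, Eventually.of_forall fun T => ?_⟩
    have h2 := Nat.floor_le (show 0 ≤ D.frac * (T : ℝ) by positivity)
    simp only [len]
    rw [Nat.cast_sub (brk_le h1 T), brk]
    linarith

theorem transpose_mul_F (m : Regime) (T : ℕ) (ω : Ω) : (D.F m T ω).transpose * D.F m T ω =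
    ∑ t ∈ Finset.Ico (D.start m T) (D.start m T + D.len m T), D.ff t ω := by
  rw [Finset.sum_Ico_eq_sum_range, Nat.add_sub_cancel_left,
    ← Fin.sum_univ_eq_sum_range (fun t => D.ff (D.start m T + t) ω)]
  ext i j
  rw [Matrix.mul_apply, Matrix.sum_apply]
  rfl

theorem isBigOp_factor_gram (h : D.BreakFraction P SigF) (m : Regime) :
    IsBigOp P (fun _ T ω => ‖(D.len m T : ℝ)⁻¹ • ((D.F m T ω).transpose * D.F m T ω) - SigF‖)
      (fun _ T => (Real.sqrt T)⁻¹) := by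
  have hX : IsBigOp P (fun _ T ω => ‖(Real.sqrt T / (D.len m T : ℝ)) •
      ∑ t ∈ Finset.Ico (D.start m T) (D.start m T + D.len m T), (D.ff t ω - SigF)‖)
      (fun _ _ => 1) := by
    cases m
    · simpa only [start, len, zero_add] using h.ff_pre
    · simpa only [start, len, Nat.add_sub_cancel' (brk_le h.frac_lt_one _)] using h.ff_post
  obtain ⟨c, hc, hlen⟩ := exists_mul_le_len h.frac_pos h.frac_lt_one m
  refine isBigOp_of_forall_filter (ι := Unit) (fun _ => hX) (fun N T => by positivity) ?_
  intro l hl hXl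
  have hT : Tendsto (fun q : (ℕ × ℕ) × Ω => q.1.2) l atTop := tendsto_T hl
  have h1 := (isBigO_refl (fun q : (ℕ × ℕ) × Ω => (Real.sqrt q.1.2)⁻¹) l).mul (hXl ())
  simp only [mul_one] at h1
  refine h1.congr' ?_ EventuallyEq.rfl
  filter_upwards [hT.eventually hlen, hT.eventually_gt_atTop 0] with q h2 h3
  have h3' : (0 : ℝ) < q.1.2 := by exact_mod_cast h3
  have h4 : (0 : ℝ) < D.len m q.1.2 := lt_of_lt_of_le (by positivity) h2
  have h5 : 0 < Real.sqrt q.1.2 := Real.sqrt_pos.2 h3'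
  rw [← Real.norm_of_nonneg (inv_nonneg.2 h5.le), ← norm_smul, smul_smul, transpose_mul_F,
    Finset.sum_sub_distrib, Finset.sum_const, Nat.card_Ico, Nat.add_sub_cancel_left, smul_sub,
    ← Nat.cast_smul_eq_nsmul ℝ, smul_smul]
  congr 2
  · congr 1; field_simp
  · rw [show (Real.sqrt q.1.2)⁻¹ * (Real.sqrt q.1.2 / (D.len m q.1.2 : ℝ)) * (D.len m q.1.2 : ℝ) = 1
      by field_simp, one_smul]

/-- The random quantities whose stochastic orders drive the argument. -/
noncomputable def primitive (D : Model Ω r) (SigF : Matrix (Fin r) (Fin r) ℝ)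
    (SigLam : Regime → Matrix (Fin r) (Fin r) ℝ) (i : Regime × Regime × Fin 8) (N T : ℕ) (ω : Ω) :
    ℝ :=
  ![‖D.err i.1 N T ω‖ ^ 2,
    ‖D.err i.1 N T ω * (D.err i.1 N T ω).transpose‖ ^ 2,
    ‖(D.F i.1 T ω).transpose * D.err i.1 N T ω‖ ^ 2,
    ‖D.err i.1 N T ω * D.Lam i.2.1 N ω‖ ^ 2,
    ‖(D.F i.1 T ω).transpose * D.err i.1 N T ω * D.Lam i.2.1 N ω‖ ^ 2,
    ‖(D.len i.1 T : ℝ)⁻¹ • ((D.F i.1 T ω).transpose * D.F i.1 T ω) - SigF‖,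
    ‖(N : ℝ)⁻¹ • ((D.Lam i.1 N ω).transpose * D.Lam i.1 N ω) - SigLam i.1‖,
    ‖(D.Lam .pre N ω).transpose * D.W N ω‖] i.2.2

/-- The orders of magnitude of the entries of `primitive`. -/
noncomputable def primitiveRate (k : Fin 8) (N T : ℕ) : ℝ :=
  ![(N : ℝ) * T, (N : ℝ) ^ 2 * T + N * T ^ 2, (N : ℝ) * T, (N : ℝ) * T, (N : ℝ) * T,
    (Real.sqrt T)⁻¹, (Real.sqrt N)⁻¹, 1] k

theorem isBigOp_primitive [IsProbabilityMeasure P] (h1 : D.Factors P SigF)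
    (h2 : D.Loadings P SigLam M) (h3 : D.Errors P tau M) (h4 : D.Independent P)
    (h5 : D.ErrorRows P tau M) (h6 : D.Moments P M) (h8 : D.BreakFraction P SigF)
    (i : Regime × Regime × Fin 8) :
    IsBigOp P (D.primitive SigF SigLam i) (primitiveRate i.2.2) := by
  obtain ⟨m, m', k⟩ := i
  have hlt := h8.frac_lt_one
  fin_cases k
  · exact isBigOp_err hlt h3 m
  · exact isBigOp_err_gram hlt h3 h5 m
  · exact isBigOp_factors_err hlt h1 h3 h4 m
  · exact isBigOp_err_loadings hlt h3 h6 m m'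
  · exact isBigOp_factors_err_loadings hlt h1 h2 h3 h4 m m'
  · exact isBigOp_factor_gram h8 m
  · exact h2.rate m
  · exact h2.orthogonal

section Normalization

variable {l : Filter ((ℕ × ℕ) × Ω)}

variable (D) in
/-- The factors of regime `m`, divided by `√T_m`. -/
noncomputable def nF (m : Regime) (q : (ℕ × ℕ) × Ω) : Matrix (Fin (D.len m q.1.2)) (Fin r) ℝ :=
  (Real.sqrt (D.len m q.1.2))⁻¹ • D.F m q.1.2 q.2

variable (D) in
/-- The loadings of regime `m`, divided by `√N`. -/
noncomputable def nLam (m : Regime) (q : (ℕ × ℕ) × Ω) : Matrix (Fin q.1.1) (Fin r) ℝ :=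
  (Real.sqrt q.1.1)⁻¹ • D.Lam m q.1.1 q.2

variable (D) in
/-- The errors of regime `m`, divided by `√(N T_m)`. -/
noncomputable def nErr (m : Regime) (q : (ℕ × ℕ) × Ω) :
    Matrix (Fin (D.len m q.1.2)) (Fin q.1.1) ℝ :=
  ((Real.sqrt (D.len m q.1.2))⁻¹ * (Real.sqrt q.1.1)⁻¹) • D.err m q.1.1 q.1.2 q.2

variable (D) in
/-- The observations of regime `m`, divided by `√(N T_m)`. -/
noncomputable def nX (m : Regime) (q : (ℕ × ℕ) × Ω) :
    Matrix (Fin (D.len m q.1.2)) (Fin q.1.1) ℝ :=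
  ((Real.sqrt (D.len m q.1.2))⁻¹ * (Real.sqrt q.1.1)⁻¹) • D.X m q.1.1 q.1.2 q.2

variable (D) in
/-- The shift `W`, divided by `√N`. -/
noncomputable def nW (q : (ℕ × ℕ) × Ω) : Matrix (Fin q.1.1) (Fin r) ℝ :=
  (Real.sqrt q.1.1)⁻¹ • D.W q.1.1 q.2

theorem nLam_post (q : (ℕ × ℕ) × Ω) :
    D.nLam .post q = D.nLam .pre q * D.Z q.1.1 q.2 + D.nW q := by
  simp only [nLam, nW, W, Matrix.smul_mul, ← smul_add, add_sub_cancel]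

theorem nX_eq (m : Regime) (q : (ℕ × ℕ) × Ω) :
    D.nX m q = D.nF m q * (D.nLam m q).transpose + D.nErr m q := by
  simp only [nX, nF, nLam, nErr, X, smul_add, Matrix.transpose_smul, Matrix.smul_mul,
    Matrix.mul_smul, smul_smul, mul_comm (Real.sqrt q.1.1)⁻¹]

theorem scaledGram_X (m : Regime) (q : (ℕ × ℕ) × Ω) :
    scaledGram (D.X m q.1.1 q.1.2 q.2) = D.nX m q * (D.nX m q).transpose := by
  simp only [nX, scaledGram, Matrix.transpose_smul, Matrix.smul_mul, Matrix.mul_smul, smul_smul]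
  rw [mul_mul_mul_comm, inv_sqrt_mul_self, inv_sqrt_mul_self, mul_inv, mul_comm]

theorem nF_gram (m : Regime) (q : (ℕ × ℕ) × Ω) : (D.nF m q).transpose * D.nF m q =
    (D.len m q.1.2 : ℝ)⁻¹ • ((D.F m q.1.2 q.2).transpose * D.F m q.1.2 q.2) := by
  simp only [nF, Matrix.transpose_smul, Matrix.smul_mul, Matrix.mul_smul, smul_smul,
    inv_sqrt_mul_self]

theorem nLam_gram (m : Regime) (q : (ℕ × ℕ) × Ω) : (D.nLam m q).transpose * D.nLam m q =
    (q.1.1 : ℝ)⁻¹ • ((D.Lam m q.1.1 q.2).transpose * D.Lam m q.1.1 q.2) := by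
  simp only [nLam, Matrix.transpose_smul, Matrix.smul_mul, Matrix.mul_smul, smul_smul,
    inv_sqrt_mul_self]

variable (hl : Tendsto Prod.fst l atTop) (h0 : 0 < D.frac) (h1 : D.frac < 1)
include hl h0 h1

theorem tendsto_len (m : Regime) : Tendsto (fun q : (ℕ × ℕ) × Ω => D.len m q.1.2) l atTop := by
  obtain ⟨c, hc, hlen⟩ := exists_mul_le_len h0 h1 m
  have h2 : Tendsto (fun q : (ℕ × ℕ) × Ω => c * (q.1.2 : ℝ)) l atTop :=
    (tendsto_natCast_atTop_atTop.comp (tendsto_T hl)).const_mul_atTop hc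
  exact tendsto_natCast_atTop_iff.1 (tendsto_atTop_mono' l ((tendsto_T hl).eventually hlen) h2)

theorem sqrt_T_isBigO (m : Regime) :
    (fun q : (ℕ × ℕ) × Ω => Real.sqrt q.1.2) =O[l] fun q => Real.sqrt (D.len m q.1.2) := by
  obtain ⟨c, hc, hlen⟩ := exists_mul_le_len h0 h1 m
  refine IsBigO.of_bound (Real.sqrt c)⁻¹ (((tendsto_T hl).eventually hlen).mono fun q hq => ?_)
  rw [Real.norm_of_nonneg (by positivity), Real.norm_of_nonneg (by positivity),
    le_inv_mul_iff₀ (Real.sqrt_pos.2 hc), ← Real.sqrt_mul hc.le]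
  exact Real.sqrt_le_sqrt hq

theorem inv_sqrt_len_isBigO (m : Regime) :
    (fun q : (ℕ × ℕ) × Ω => (Real.sqrt (D.len m q.1.2))⁻¹) =O[l] invDelta := by
  refine IsBigO.trans ?_ (inv_sqrt_T_isBigO hl)
  refine (sqrt_T_isBigO hl h0 h1 m).inv_rev ?_
  filter_upwards [(tendsto_sqrt_T hl).eventually_gt_atTop 0] with q hq h
  exact absurd h hq.ne'

end Normalization
end Model
end FactorBreak

/-! ### Orders of the normalized quantities -/

namespace FactorBreak

attribute [local instance] Matrix.frobeniusNormedSpace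

open Asymptotics

namespace Model

section Orders

variable {Ω : Type*} [MeasurableSpace Ω] {r : ℕ}
  {D : Model Ω r} {SigF : Matrix (Fin r) (Fin r) ℝ} {SigLam : Regime → Matrix (Fin r) (Fin r) ℝ}
  {l : Filter ((ℕ × ℕ) × Ω)} (hl : Tendsto Prod.fst l atTop)
  (hp : ∀ i, (fun q => D.primitive SigF SigLam i q.1.1 q.1.2 q.2) =O[l]
    fun q => primitiveRate i.2.2 q.1.1 q.1.2)

section
include hl hp

theorem tendsto_nF_gram (m : Regime) :
    Tendsto (fun q => (D.nF m q).transpose * D.nF m q) l (𝓝 SigF) := by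
  refine tendsto_of_bigO_norm_sub (a := fun q => (Real.sqrt q.1.2)⁻¹) ?_
    (tendsto_inv_atTop_zero.comp (tendsto_sqrt_T hl))
  simp only [nF_gram]
  exact hp (m, m, 5)

theorem tendsto_nLam_gram (m : Regime) :
    Tendsto (fun q => (D.nLam m q).transpose * D.nLam m q) l (𝓝 (SigLam m)) := by
  refine tendsto_of_bigO_norm_sub (a := fun q => (Real.sqrt q.1.1)⁻¹) ?_
    (tendsto_inv_atTop_zero.comp (tendsto_sqrt_N hl))
  simp only [nLam_gram]
  exact hp (m, m, 6)

theorem nF_bounded (m : Regime) : (fun q => ‖D.nF m q‖) =O[l] fun _ => (1 : ℝ) :=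
  bounded_of_gram (bigO_one_of_tendsto (tendsto_nF_gram hl hp m))

theorem orthogonality : (fun q => ‖(D.nLam .pre q).transpose * D.nW q‖) =O[l]
    fun q => invDelta q * invDelta q := by
  have h2 := bigO_smul ((inv_sqrt_N_isBigO hl).mul (inv_sqrt_N_isBigO hl)) (hp (.pre, .pre, 7))
  refine (h2.congr_left fun q => ?_).trans (IsBigO.of_bound 1 (Eventually.of_forall fun q => ?_))
  · simp only [nLam, nW, Matrix.transpose_smul, Matrix.smul_mul, Matrix.mul_smul, smul_smul]
  · change ‖_ * (1 : ℝ)‖ ≤ _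
    rw [mul_one, one_mul]

end

variable (h0 : 0 < D.frac) (h1 : D.frac < 1)
include hl h0 h1

theorem eventually_sqrt_len_ne_zero (m : Regime) :
    ∀ᶠ q : (ℕ × ℕ) × Ω in l, Real.sqrt (D.len m q.1.2) ≠ 0 :=
  (((tendsto_len hl h0 h1 m).eventually_gt_atTop 0)).mono fun q hq =>
    (Real.sqrt_pos.2 (by exact_mod_cast hq)).ne'

theorem isBigO_sqrt_of_sq (m : Regime) {g : (ℕ × ℕ) × Ω → ℝ}
    (hg : (fun q => g q ^ 2) =O[l] fun q => (q.1.1 : ℝ) * q.1.2) :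
    g =O[l] fun q => Real.sqrt q.1.1 * Real.sqrt (D.len m q.1.2) := by
  have h2 : g =O[l] fun q => Real.sqrt q.1.1 * Real.sqrt q.1.2 := by
    refine IsBigO.of_pow two_ne_zero (hg.congr_right fun q => ?_)
    simp only [Pi.pow_apply]
    rw [mul_pow, Real.sq_sqrt (Nat.cast_nonneg _), Real.sq_sqrt (Nat.cast_nonneg _)]
  exact h2.trans ((isBigO_refl _ l).mul (sqrt_T_isBigO hl h0 h1 m))

theorem scaled_isBigO_one (m : Regime) :
    (fun q : (ℕ × ℕ) × Ω => (Real.sqrt (D.len m q.1.2))⁻¹ * (Real.sqrt q.1.1)⁻¹ *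
      (Real.sqrt q.1.1 * Real.sqrt (D.len m q.1.2))) =O[l] fun _ => (1 : ℝ) := by
  refine (isBigO_refl _ l).congr' EventuallyEq.rfl ?_
  filter_upwards [(tendsto_sqrt_N hl).eventually_gt_atTop 0,
    eventually_sqrt_len_ne_zero hl h0 h1 m] with q h2 h3
  field_simp

include hp

theorem normalizedErrors (m : Regime) :
    NormalizedErrors l invDelta (D.nF m) (D.nErr m) := by
  have hc := isBigO_refl (fun q : (ℕ × ℕ) × Ω =>
    (Real.sqrt (D.len m q.1.2))⁻¹ * (Real.sqrt q.1.1)⁻¹) l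
  have hs := scaled_isBigO_one hl h0 h1 m
  refine ⟨?_, ?_, ?_⟩
  · exact (bigO_smul hc (isBigO_sqrt_of_sq hl h0 h1 m (hp (m, m, 0)))).trans hs
  · have h2 : (fun q : (ℕ × ℕ) × Ω => ‖D.err m q.1.1 q.1.2 q.2 *
        (D.err m q.1.1 q.1.2 q.2).transpose‖) =O[l]
        fun q => Real.sqrt q.1.1 * Real.sqrt q.1.1 * (Real.sqrt q.1.2 * Real.sqrt q.1.2) *
          invDelta q := by
      refine IsBigO.of_pow two_ne_zero (IsBigO.trans (hp (m, m, 1)) ?_)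
      have h3 := (isBigO_refl (fun q : (ℕ × ℕ) × Ω => ((Real.sqrt q.1.1 * Real.sqrt q.1.1 *
        (Real.sqrt q.1.2 * Real.sqrt q.1.2)) ^ 2)) l).mul
        (((inv_sqrt_N_isBigO hl).pow 2).add ((inv_sqrt_T_isBigO hl).pow 2))
      refine h3.congr' ?_ (Eventually.of_forall fun q => ?_)
      · filter_upwards [(tendsto_sqrt_N hl).eventually_gt_atTop 0,
          (tendsto_sqrt_T hl).eventually_gt_atTop 0] with q h4 h5
        change _ = (q.1.1 : ℝ) ^ 2 * q.1.2 + q.1.1 * q.1.2 ^ 2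
        obtain ⟨x, hx⟩ : ∃ x, x = Real.sqrt q.1.1 := ⟨_, rfl⟩
        obtain ⟨y, hy⟩ : ∃ y, y = Real.sqrt q.1.2 := ⟨_, rfl⟩
        have h6 : (q.1.1 : ℝ) = x ^ 2 := by rw [hx, Real.sq_sqrt (Nat.cast_nonneg _)]
        have h7 : (q.1.2 : ℝ) = y ^ 2 := by rw [hy, Real.sq_sqrt (Nat.cast_nonneg _)]
        rw [← hx] at h4 ⊢
        rw [← hy] at h5 ⊢
        rw [h6, h7]
        field_simp
        ring
      · simp only [Pi.pow_apply]
        ring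
    have h3 := h2.trans (((isBigO_refl _ l).mul ((sqrt_T_isBigO hl h0 h1 m).mul
      (sqrt_T_isBigO hl h0 h1 m))).mul (isBigO_refl _ l))
    refine ((bigO_smul (hc.mul hc) h3).congr_left fun q => ?_).trans ?_
    · simp only [nErr, Matrix.transpose_smul, Matrix.smul_mul, Matrix.mul_smul, smul_smul]
    · have h4 := (hs.mul hs).mul (isBigO_refl invDelta l)
      simp only [one_mul] at h4
      exact h4.congr_left fun q => by ring
  · have h2 := (bigO_smul ((inv_sqrt_len_isBigO hl h0 h1 m).mul hc)
      (isBigO_sqrt_of_sq hl h0 h1 m (hp (m, m, 2)))).congr_left fun q => show _ =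
        ‖(D.nF m q).transpose * D.nErr m q‖ by
      simp only [nErr, nF, Matrix.transpose_smul, Matrix.smul_mul, Matrix.mul_smul, smul_smul,
        mul_comm, mul_left_comm]
    have h4 := (isBigO_refl invDelta l).mul hs
    simp only [mul_one] at h4
    exact h2.trans (h4.congr_left fun q => by ring)

theorem weaklyCorrelated (m m' : Regime) :
    WeaklyCorrelated l invDelta (D.nF m) (D.nErr m) (D.nLam m') := by
  have hc := isBigO_refl (fun q : (ℕ × ℕ) × Ω =>
    (Real.sqrt (D.len m q.1.2))⁻¹ * (Real.sqrt q.1.1)⁻¹) l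
  have hs := scaled_isBigO_one hl h0 h1 m
  refine ⟨?_, ?_, ?_⟩
  · exact bounded_of_gram (bigO_one_of_tendsto (tendsto_nLam_gram hl hp m'))
  · have h2 := (bigO_smul ((inv_sqrt_N_isBigO hl).mul hc)
      (isBigO_sqrt_of_sq hl h0 h1 m (hp (m, m', 3)))).congr_left fun q => show _ =
        ‖D.nErr m q * D.nLam m' q‖ by
      simp only [nErr, nLam, Matrix.smul_mul, Matrix.mul_smul, smul_smul, mul_comm]
    have h4 := (isBigO_refl invDelta l).mul hs
    simp only [mul_one] at h4
    exact h2.trans (h4.congr_left fun q => by ring)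
  · have h2 := (bigO_smul (((inv_sqrt_len_isBigO hl h0 h1 m).mul (inv_sqrt_N_isBigO hl)).mul hc)
      (isBigO_sqrt_of_sq hl h0 h1 m (hp (m, m', 4)))).congr_left fun q => show _ =
        ‖(D.nF m q).transpose * D.nErr m q * D.nLam m' q‖ by
      simp only [nErr, nLam, nF, Matrix.transpose_smul, Matrix.smul_mul, Matrix.mul_smul,
        smul_smul]
      congr 2
      ring
    have h4 := (isBigO_refl (fun q => invDelta q * invDelta q) l).mul hs
    simp only [mul_one] at h4
    exact h2.trans (h4.congr_left fun q => by ring)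

theorem normalizedComponents (hF : SigF.PosDef) (hL : ∀ m, (SigLam m).PosDef)
    {Ft : (m : Regime) → (N T : ℕ) → Ω → Matrix (Fin (D.len m T)) (Fin r) ℝ}
    (hFt : ∀ m N T ω, r ≤ D.len m T → IsPrincipalComponents (D.X m N T ω) (Ft m N T ω))
    (m : Regime) :
    NormalizedComponents l (D.nF m) (D.nErr m) (D.nLam m) (D.nX m)
      (fun q => (Real.sqrt (D.len m q.1.2))⁻¹ • Ft m q.1.1 q.1.2 q.2)
      (fun q => D.V m q.1.1 q.1.2 q.2) := by
  have hr : ∀ᶠ q in l, r ≤ D.len m q.1.2 := (tendsto_len hl h0 h1 m).eventually_ge_atTop r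
  obtain ⟨c, hc, hV⟩ := exists_eventually_le_topEigenvalues_of_factor_model hF (hL m) hr
    (f := D.nF m) (u := D.nErr m) (lam := D.nLam m) (x := D.nX m) (d := invDelta)
    (tendsto_invDelta hl) (nX_eq m) (X := fun q => D.X m q.1.1 q.1.2 q.2) (scaledGram_X m)
    (tendsto_nF_gram hl hp m) (tendsto_nLam_gram hl hp m)
    (normalizedErrors hl hp h0 h1 m).factor_err (weaklyCorrelated hl hp h0 h1 m m).factor_err
  obtain ⟨hU, hI⟩ := isUnit_diagonal_of_le hc hV
  refine ⟨nX_eq m, ?_, ?_, hU, hI⟩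
  · filter_upwards [hr, eventually_sqrt_len_ne_zero hl h0 h1 m] with q h2 h3
    rw [Matrix.transpose_smul, Matrix.smul_mul, Matrix.mul_smul, smul_smul,
      (hFt m q.1.1 q.1.2 q.2 h2).normalized, smul_smul, inv_sqrt_mul_self,
      inv_mul_cancel₀ fun h => h3 (by rw [h, Real.sqrt_zero]), one_smul]
  · filter_upwards [hr] with q h2
    rw [← scaledGram_X, Matrix.mul_smul, (hFt m q.1.1 q.1.2 q.2 h2).eigen, Matrix.smul_mul]
    rfl

theorem Z_bounded (hL : (SigLam .pre).PosDef) :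
    (fun q => ‖D.Z q.1.1 q.2‖) =O[l] fun _ => (1 : ℝ) := by
  obtain ⟨hU, hI⟩ := eventually_isUnit_of_tendsto (tendsto_nLam_gram hl hp .pre) hL.isUnit
  have h2 := bigO_mul (bigO_transpose (weaklyCorrelated hl hp h0 h1 .pre .pre).bounded)
    (weaklyCorrelated hl hp h0 h1 .pre .post).bounded
  have h3 := (orthogonality hl hp).trans ((isBigO_one_mul_self (tendsto_invDelta hl)).trans
    ((tendsto_invDelta hl).isBigO_one ℝ))
  simp only [mul_one] at h2
  have h4 := bigO_mul hI (bigO_sub h2 h3)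
  simp only [mul_one] at h4
  refine bigO_congr h4 (hU.mono fun q hq => ?_)
  rw [← Matrix.mul_sub, nLam_post, add_sub_cancel_right, ← Matrix.mul_assoc, ← Matrix.mul_assoc,
    Matrix.mul_assoc _ _ (D.nLam .pre q),
    Matrix.nonsing_inv_mul _ ((Matrix.isUnit_iff_isUnit_det _).1 hq), Matrix.one_mul]

/-- The theorem along a filter of joint limits on which the primitive orders hold
deterministically. -/
theorem break_limit (hF : SigF.PosDef) (hL : ∀ m, (SigLam m).PosDef)
    {Ft : (m : Regime) → (N T : ℕ) → Ω → Matrix (Fin (D.len m T)) (Fin r) ℝ}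
    (hFt : ∀ m N T ω, r ≤ D.len m T → IsPrincipalComponents (D.X m N T ω) (Ft m N T ω))
    {Lt : (m : Regime) → (N T : ℕ) → Ω → Matrix (Fin N) (Fin r) ℝ}
    (hLt : ∀ m N T ω, Lt m N T ω = estLoadings (D.X m N T ω) (Ft m N T ω))
    {Zt : ℕ → ℕ → Ω → Matrix (Fin r) (Fin r) ℝ}
    (hZt : ∀ N T ω, Zt N T ω = projCoef (Lt .pre N T ω) (Lt .post N T ω))
    {Wt : (N T : ℕ) → Ω → Matrix (Fin N) (Fin r) ℝ}
    (hWt : ∀ N T ω, Wt N T ω = Lt .post N T ω - Lt .pre N T ω * Zt N T ω)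
    {H₁ H₂ : ℕ → ℕ → Ω → Matrix (Fin r) (Fin r) ℝ}
    (hH₁ : ∀ N T ω, H₁ N T ω = D.H₁ N T ω (Ft .pre N T ω))
    (hH₂ : ∀ N T ω, H₂ N T ω = D.H₂ N T ω (Ft .post N T ω)) :
    (∀ᶠ q in l, IsUnit (D.V .pre q.1.1 q.1.2 q.2) ∧ IsUnit (D.V .post q.1.1 q.1.2 q.2) ∧
      IsUnit ((Lt .pre q.1.1 q.1.2 q.2).transpose * Lt .pre q.1.1 q.1.2 q.2) ∧
      IsUnit (H₂ q.1.1 q.1.2 q.2)) ∧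
    ((fun q => ‖Zt q.1.1 q.1.2 q.2 - (H₁ q.1.1 q.1.2 q.2).transpose * D.Z q.1.1 q.2 *
      ((H₂ q.1.1 q.1.2 q.2)⁻¹).transpose‖) =O[l] fun q => invDelta q * invDelta q) ∧
    (fun q => (q.1.1 : ℝ)⁻¹ * ‖Wt q.1.1 q.1.2 q.2 - D.W q.1.1 q.2 *
      ((H₂ q.1.1 q.1.2 q.2)⁻¹).transpose‖ ^ 2) =O[l] fun q => invDelta q * invDelta q := by
  have c := normalizedComponents hl hp h0 h1 hF hL hFt
  have hLn : ∀ m q, (D.nX m q).transpose *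
      ((Real.sqrt (D.len m q.1.2))⁻¹ • Ft m q.1.1 q.1.2 q.2) =
      (Real.sqrt q.1.1)⁻¹ • Lt m q.1.1 q.1.2 q.2 := fun m q => by
    rw [hLt, estLoadings, nX]
    simp only [Matrix.transpose_smul, Matrix.smul_mul, Matrix.mul_smul, smul_smul]
    rw [← inv_sqrt_mul_self]
    congr 1
    ring
  have hu : ∀ᶠ q in l,
      IsUnit ((Lt .pre q.1.1 q.1.2 q.2).transpose * Lt .pre q.1.1 q.1.2 q.2) := by
    filter_upwards [(c .pre).isUnit, (c .pre).loadings_gram] with q h2 h3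
    rw [hLn, Matrix.transpose_smul, Matrix.smul_mul, Matrix.mul_smul, smul_smul] at h3
    rw [← h3] at h2
    rw [Matrix.isUnit_iff_isUnit_det, Matrix.det_smul] at h2
    exact (Matrix.isUnit_iff_isUnit_det _).2 (isUnit_of_mul_isUnit_right h2)
  have hA : ∀ m q, (D.nF m q).transpose * ((Real.sqrt (D.len m q.1.2))⁻¹ • Ft m q.1.1 q.1.2 q.2) =
      (D.len m q.1.2 : ℝ)⁻¹ • ((D.F m q.1.2 q.2).transpose * Ft m q.1.1 q.1.2 q.2) := fun m q => by
    simp only [nF, Matrix.transpose_smul, Matrix.smul_mul, Matrix.mul_smul, smul_smul,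
      inv_sqrt_mul_self]
  obtain ⟨hU, hZ, hW⟩ := normalized_break (tendsto_invDelta hl) (c .pre) (c .post)
    (nF_bounded hl hp .pre) (nF_bounded hl hp .post)
    (normalizedErrors hl hp h0 h1 .pre) (normalizedErrors hl hp h0 h1 .post)
    (weaklyCorrelated hl hp h0 h1 .pre .pre) (weaklyCorrelated hl hp h0 h1 .pre .post)
    (weaklyCorrelated hl hp h0 h1 .post .pre) (weaklyCorrelated hl hp h0 h1 .post .post)
    nLam_post (Z_bounded hl hp h0 h1 (hL .pre)) (orthogonality hl hp)
    (Zt := fun q => Zt q.1.1 q.1.2 q.2) (H₁ := fun q => H₁ q.1.1 q.1.2 q.2)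
    (H₂ := fun q => H₂ q.1.1 q.1.2 q.2)
    (by
      filter_upwards [hu, (tendsto_sqrt_N hl).eventually_gt_atTop 0] with q h2 h3
      rw [hLn, hLn, hZt, projCoef_smul (inv_ne_zero h3.ne') _ _ h2])
    (fun q => by rw [hH₁, Model.H₁, hA, nLam_gram])
    (fun q => by
      rw [hH₂, Model.H₂, hA]
      simp only [nLam, nW, Matrix.transpose_smul, Matrix.smul_mul, Matrix.mul_smul, smul_smul,
        inv_sqrt_mul_self])
  refine ⟨?_, hZ, ?_⟩
  · filter_upwards [(c .pre).isUnit, (c .post).isUnit, hu, hU] with q h2 h3 h4 h5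
    exact ⟨h2, h3, h4, h5⟩
  · refine (hW.mul hW).congr_left fun q => ?_
    rw [hLn, hLn, nW, Matrix.smul_mul, Matrix.smul_mul, ← smul_sub, ← smul_sub, ← hWt, norm_smul,
      norm_inv, Real.norm_of_nonneg (Real.sqrt_nonneg _), mul_mul_mul_comm, inv_sqrt_mul_self, sq]

end Orders
end Model
end FactorBreak

/-! ### The main result -/

theorem theorem1 {Ω : Type*} [MeasurableSpace Ω] (P : Measure Ω) [IsProbabilityMeasure P]
    {r : ℕ} (D : FactorBreak.Model Ω r)
    (SigF : Matrix (Fin r) (Fin r) ℝ) (SigLam : FactorBreak.Regime → Matrix (Fin r) (Fin r) ℝ)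
    (tau : ℕ → ℕ → ℝ) (M : ℝ)
    (h1 : D.Factors P SigF)
    (h2 : D.Loadings P SigLam M)
    (h3 : D.Errors P tau M)
    (h4 : D.Independent P)
    (h5 : D.ErrorRows P tau M)
    (h6 : D.Moments P M)
    (h7 : FactorBreak.Model.DistinctEigenvalues SigF SigLam)
    (h8 : D.BreakFraction P SigF)
    (Ft : (m : FactorBreak.Regime) → (N T : ℕ) → Ω → Matrix (Fin (D.len m T)) (Fin r) ℝ)
    (hFt : ∀ m N T ω, r ≤ D.len m T →
      FactorBreak.IsPrincipalComponents (D.X m N T ω) (Ft m N T ω))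
    (Lt : (m : FactorBreak.Regime) → (N T : ℕ) → Ω → Matrix (Fin N) (Fin r) ℝ)
    (hLt : ∀ m N T ω, Lt m N T ω = FactorBreak.estLoadings (D.X m N T ω) (Ft m N T ω))
    (Zt : ℕ → ℕ → Ω → Matrix (Fin r) (Fin r) ℝ)
    (hZt : ∀ N T ω, Zt N T ω = FactorBreak.projCoef (Lt .pre N T ω) (Lt .post N T ω))
    (Wt : (N T : ℕ) → Ω → Matrix (Fin N) (Fin r) ℝ)
    (hWt : ∀ N T ω, Wt N T ω = Lt .post N T ω - Lt .pre N T ω * Zt N T ω)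
    (H₁ H₂ : ℕ → ℕ → Ω → Matrix (Fin r) (Fin r) ℝ)
    (hH₁ : ∀ N T ω, H₁ N T ω = D.H₁ N T ω (Ft .pre N T ω))
    (hH₂ : ∀ N T ω, H₂ N T ω = D.H₂ N T ω (Ft .post N T ω)) :
    -- with probability tending to one, all the matrices that are inverted are invertible
    Tendsto (fun p : ℕ × ℕ => P {ω | ¬ (IsUnit (D.V .pre p.1 p.2 ω) ∧
        IsUnit (D.V .post p.1 p.2 ω) ∧
        IsUnit ((Lt .pre p.1 p.2 ω).transpose * Lt .pre p.1 p.2 ω) ∧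
        IsUnit (H₂ p.1 p.2 ω))}) atTop (𝓝 0) ∧
    FactorBreak.IsBigOp P
      (fun N T ω => ‖Zt N T ω -
        (H₁ N T ω).transpose * D.Z N ω * ((H₂ N T ω)⁻¹).transpose‖)
      (fun N T => 1 / FactorBreak.delta N T ^ 2) ∧
    FactorBreak.IsBigOp P
      (fun N T ω => (N : ℝ)⁻¹ *
        ‖Wt N T ω - D.W N ω * ((H₂ N T ω)⁻¹).transpose‖ ^ 2)
      (fun N T => 1 / FactorBreak.delta N T ^ 2) := by
  have h0 := h8.frac_pos
  have h1' := h8.frac_lt_one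
  have hX := FactorBreak.Model.isBigOp_primitive (D := D) (SigLam := SigLam) h1 h2 h3 h4 h5 h6 h8
  have key := fun (l : Filter ((ℕ × ℕ) × Ω)) hl hp =>
    FactorBreak.Model.break_limit (l := l) (D := D) (SigF := SigF) (SigLam := SigLam) hl hp h0 h1'
      h1.posDef h2.posDef hFt hLt hZt hWt hH₁ hH₂
  have hrate : ∀ q : (ℕ × ℕ) × Ω, FactorBreak.invDelta q * FactorBreak.invDelta q =
      1 / FactorBreak.delta q.1.1 q.1.2 ^ 2 := fun q => by
    rw [FactorBreak.invDelta, ← mul_inv, ← sq, one_div]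
  refine ⟨FactorBreak.tendsto_measure_of_forall_filter (S := fun N T ω =>
      IsUnit (D.V .pre N T ω) ∧ IsUnit (D.V .post N T ω) ∧
        IsUnit ((Lt .pre N T ω).transpose * Lt .pre N T ω) ∧ IsUnit (H₂ N T ω)) hX
      fun l hl hp => (key l hl hp).1,
    FactorBreak.isBigOp_of_forall_filter hX (fun N T => by positivity)
      fun l hl hp => (key l hl hp).2.1.congr_right hrate,
    FactorBreak.isBigOp_of_forall_filter hX (fun N T => by positivity)
      fun l hl hp => (key l hl hp).2.2.congr_right hrate⟩
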